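/- All registers are finite-dimensional complex Hilbert spaces and logarithms are to base $2$. For a state $\sigma$ let $H(\sigma)=-\operatorname{Tr}\sigma\log\sigma$ (with $0\log 0=0$), $H(A|B)=H(AB)-H(B)$ and $I(A;B|C)=H(A|C)-H(A|BC)$. **Protocols.** An $M$-message protocol $\Pi$ ($M\in\mathbb N$) from $A_{in}\otimes B_{in}$ to $A_{out}\otimes B_{out}$ consists of a pure state $\psi$ shared by Alice and Bob on arbitrary finite-dimensional registers $T_A,T_B$ and of local unitaries. Alice starts with $A_{in}T_A$, Bob with $B_{in}T_B$. Beginning with Alice, the parties alternate: in step $i=1,\dots,M$ the sender applies a unitary from the register she or he holds to (memory) $\otimes\, C_i$, where the memory and $C_i$ are arbitrary finite-dimensional registers, keeps the memory, and sends $C_i$ to the other party. At the end Alice's register is unitarily mapped to $A_{out}\otimes A'$ and Bob's to $B_{out}\otimes B'$, and $A',B'$ are traced out. Let $\rho$ be a state on $A_{in}\otimes B_{in}$ and let $\rho^{A_{in}B_{in}R}$ be a purification of it. Write $\Pi(\rho)$ for the final state on $A_{out}B_{out}R$ when the protocol is run on this purification. The quantum information cost is $$QIC(\Pi,\rho)=\sum_{i\text{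 odd}}\tfrac12 I(C_i;R|B_{i-1})+\sum_{i\text{ even}}\tfrac12 I(C_i;R|A_{i-1}),$$ where $i$ runs over $1,\dots,M$, $A_{i-1}$ resp. $B_{i-1}$ is the memory that the receiver (Alice resp. Bob) holds while $C_i$ is in transit, $B_0=B_{in}\otimes T_B$, and the $i$-th term is evaluated in the state at that moment. **Complexity.** For a channel (completely positive trace-preserving map) $\mathcal N$ from $A_{in}\otimes B_{in}$ to $A_{out}\otimes B_{out}$ and $\epsilon\in[0,2]$, let $\mathcal T^M(\mathcal N,\rho,\epsilon)$ be the set of $M$-message protocols with $\|\Pi(\rho)-(\mathcal N\otimes\mathrm{id}_R)(\rho^{A_{in}B_{in}R})\|_1\le\epsilon$, where $\|X\|_1=\operatorname{Tr}|X|$, and let $\mathcal T(\mathcal N,\rho,\epsilon)=\bigcup_{M\in\mathbb N}\mathcal T^M(\mathcal N,\rho,\epsilon)$. Set $$QIC(\mathcal N,\rho,\epsilon)=\inf_{\Pi\in\mathcal T(\mathcal N,\rho,\epsilon)}QIC(\Pi,\rho),\qquad QIC^M(\mathcal N,\rho,\epsilon)=\inf_{\Pi\in\mathcal T^M(\mathcal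 N,\rho,\epsilon)}QIC(\Pi,\rho),$$ with $\inf\emptyset=+\infty$ and $0\cdot(+\infty)=0$. **Corollary (joint convexity).** Let $p\in[0,1]$, let $\mathcal N_1,\mathcal N_2$ be channels from $A_{in}\otimes B_{in}$ to $A_{out}\otimes B_{out}$, let $\epsilon_1,\epsilon_2\in[0,2]$, $M_1,M_2\in\mathbb N$, and put $\mathcal N=p\mathcal N_1+(1-p)\mathcal N_2$, $\epsilon=p\epsilon_1+(1-p)\epsilon_2$, $M=\max(M_1,M_2)$. Then for every state $\rho$ on $A_{in}\otimes B_{in}$ and every purification $\rho^{A_{in}B_{in}R}$ of it, used in all the quantities, $$QIC(\mathcal N,\rho,\epsilon)\le p\,QIC(\mathcal N_1,\rho,\epsilon_1)+(1-p)\,QIC(\mathcal N_2,\rho,\epsilon_2),$$ $$QIC^M(\mathcal N,\rho,\epsilon)\le p\,QIC^{M_1}(\mathcal N_1,\rho,\epsilon_1)+(1-p)\,QIC^{M_2}(\mathcal N_2,\rho,\epsilon_2).$$ -/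

import Mathlib

/-!
Finite-dimensional quantum registers are represented by finite index types: the register `A`
stands for the Hilbert space with orthonormal basis `A`, operators are complex matrices, pure states
are unit vectors `A → ℂ`, and `A ⊗ B` is `A × B`.
-/

namespace QInfo

open scoped ComplexOrder Matrix

/-! ### States, channels, entropies -/

/-- Density operators: positive semidefinite with unit trace. -/
def IsDensity {A : Type} [Fintype A] (ρ : Matrix A A ℂ) : Prop :=
  ρ.PosSemidef ∧ ρ.trace = 1

/-- `|v⟩⟨v|`. -/
def pureState {A : Type} (v : A → ℂ) : Matrix A A ℂ :=
  Matrix.vecMulVec v (star v)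

/-- `ρ^{A} = Tr_B ρ^{AB}`. -/
def trRight {A B : Type} [Fintype B] (ρ : Matrix (A × B) (A × B) ℂ) : Matrix A A ℂ :=
  fun a a' => ∑ b, ρ (a, b) (a', b)

/-- `ρ^{B} = Tr_A ρ^{AB}`. -/
def trLeft {A B : Type} [Fintype A] (ρ : Matrix (A × B) (A × B) ℂ) : Matrix B B ℂ :=
  fun b b' => ∑ a, ρ (a, b) (a, b')

/-- `ρ^{AC} = Tr_B ρ^{ABC}`. -/
def trMid {A B C : Type} [Fintype B] (ρ : Matrix (A × B × C) (A × B × C) ℂ) :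
    Matrix (A × C) (A × C) ℂ :=
  fun x y => ∑ b, ρ (x.1, b, x.2) (y.1, b, y.2)

/-- The vector `φ` on `A ⊗ R` is a purification of `ρ` with reference register `R`. -/
def IsPurification {A R : Type} [Fintype R] (φ : A × R → ℂ) (ρ : Matrix A A ℂ) : Prop :=
  trRight (pureState φ) = ρ

/-- `𝒩 ⊗ id_R`. -/
def withRef {A B : Type} (N : Matrix A A ℂ →ₗ[ℂ] Matrix B B ℂ) (R : Type)
    (ρ : Matrix (A × R) (A × R) ℂ) : Matrix (B × R) (B × R) ℂ :=
  fun x y => N (fun a a' => ρ (a, x.2) (a', y.2)) x.1 y.1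

/-- Quantum channels: completely positive, trace-preserving linear maps. -/
structure IsChannel {A B : Type} [Fintype A] [Fintype B]
    (N : Matrix A A ℂ →ₗ[ℂ] Matrix B B ℂ) : Prop where
  completely_positive : ∀ (k : ℕ) (ρ : Matrix (A × Fin k) (A × Fin k) ℂ),
    ρ.PosSemidef → (withRef N (Fin k) ρ).PosSemidef
  trace_preserving : ∀ ρ : Matrix A A ℂ, (N ρ).trace = ρ.trace

open Classical in
/-- Unitary operators from the space `A` onto the space `B`. -/
def IsUnitary {A B : Type} [Fintype A] [Fintype B] (U : Matrix B A ℂ) : Prop :=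
  Uᴴ * U = 1 ∧ U * Uᴴ = 1

open Classical in
/-- The trace distance `Tr |ρ - σ|` of two states: the sum of the absolute values of the eigenvalues
of the (Hermitian) difference, with multiplicity. -/
noncomputable def traceDist {A : Type} [Fintype A] (ρ σ : Matrix A A ℂ) : ℝ :=
  ((ρ - σ).charpoly.roots.map fun z => ‖z‖).sum

open Classical in
/-- The von Neumann entropy `H(ρ) = - ∑ λ log₂ λ` over the eigenvalues `λ` of the state `ρ` (which
are real), with multiplicity. -/
noncomputable def entropy {A : Type} [Fintype A] (ρ : Matrix A A ℂ) : ℝ :=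
  (ρ.charpoly.roots.map fun z => -(z.re * Real.logb 2 z.re)).sum

/-- `H(A | B) = H(AB) - H(B)`. -/
noncomputable def condEntropy {A B : Type} [Fintype A] [Fintype B]
    (ρ : Matrix (A × B) (A × B) ℂ) : ℝ :=
  entropy ρ - entropy (trLeft ρ)

/-- `I(A ; B | C) = H(A | C) - H(A | BC)`. -/
noncomputable def condMutualInfo {A B C : Type} [Fintype A] [Fintype B] [Fintype C]
    (ρ : Matrix (A × B × C) (A × B × C) ℂ) : ℝ :=
  condEntropy (trMid ρ) - condEntropy ρ

/-! ### Interactive protocols -/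

/-- `Strategy n X Y S W` is what remains of a protocol when `n` messages are still to be exchanged,
the party whose turn it is holds the register `S`, the other one holds `W`, and they have to
output the registers `X` and `Y`, respectively.
* `send`: the active party applies a unitary from `S` to `S' ⊗ C`, keeps the memory `S'` and sends
  the communication register `C`; then the other party, who now holds `W ⊗ C`, is active.
* `done`: no message is left, and each party splits what it holds, after a local unitary, into its
  output and a register that is discarded. (When at least one message was sent, `V` is a part of
  the unitary with which the waiting party prepared the last message.) -/
inductive Strategy : (n : ℕ) → (X Y S W : Type) →
    [Fintype X] → [Fintype Y] → [Fintype S] → [Fintype W] → Type 1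
  | done {X Y S W : Type} [Fintype X] [Fintype Y] [Fintype S] [Fintype W]
      (S' W' : Type) [Fintype S'] [Fintype W']
      (U : Matrix (X × S') S ℂ) (hU : IsUnitary U)
      (V : Matrix (Y × W') W ℂ) (hV : IsUnitary V) : Strategy 0 X Y S W
  | send {n : ℕ} {X Y S W : Type} [Fintype X] [Fintype Y] [Fintype S] [Fintype W]
      (S' C : Type) [Fintype S'] [Fintype C]
      (U : Matrix (S' × C) S ℂ) (hU : IsUnitary U)
      (rest : Strategy n Y X (W × C) S') : Strategy (n + 1) X Y S W

/-- `(U ⊗ 1_W ⊗ 1_R) v`. -/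
def actLeft {S T W R : Type} [Fintype S] (U : Matrix T S ℂ) (v : (S × W) × R → ℂ) :
    (T × W) × R → ℂ :=
  fun x => ∑ s, U x.1.1 s * v ((s, x.1.2), x.2)

/-- `(1_S ⊗ V ⊗ 1_R) v`. -/
def actRight {S T W R : Type} [Fintype W] (V : Matrix T W ℂ) (v : (S × W) × R → ℂ) :
    (S × T) × R → ℂ :=
  fun x => ∑ w, V x.1.2 w * v ((x.1.1, w), x.2)

/-- The same state with the message `C` handed over to the other party. -/
def handOver {S C W R : Type} (v : ((S × C) × W) × R → ℂ) : ((W × C) × S) × R → ℂ :=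
  fun x => v (((x.1.2, x.1.1.2), x.1.1.1), x.2)

/-- The state of `C ⊗ R ⊗ W` (message, reference, memory of the receiver) while the message is in
transit: the memory `S` of the sender is traced out. -/
def transitState {S C W R : Type} [Fintype S] (v : ((S × C) × W) × R → ℂ) :
    Matrix (C × R × W) (C × R × W) ℂ :=
  fun x y => ∑ s, pureState v (((s, x.1), x.2.2), x.2.1) (((s, y.1), y.2.2), y.2.1)

/-- The sum of `½ I(Cᵢ ; R | memory of the receiver)` over the remaining messages, from the joint
pure state `v` of both parties and the reference register. -/
noncomputable def Strategy.cost {R : Type} [Fintype R] :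
    {n : ℕ} → {X Y S W : Type} → [Fintype X] → [Fintype Y] → [Fintype S] → [Fintype W] →
    Strategy n X Y S W → ((S × W) × R → ℂ) → ℝ
  | _, _, _, _, _, _, _, _, _, @Strategy.done _ _ _ _ _ _ _ _ _ _ _ _ _ _ _ _, _ => 0
  | _, _, _, _, _, _, _, _, _, @Strategy.send _ _ _ _ _ _ _ _ _ _ _ _ _ U _ rest, v =>
      (1 / 2) * condMutualInfo (transitState (actLeft U v))
        + rest.cost (handOver (actLeft U v))

/-- The final state of the two output registers and the reference register. -/
noncomputable def Strategy.output {R : Type} :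
    {n : ℕ} → {X Y S W : Type} → [Fintype X] → [Fintype Y] → [Fintype S] → [Fintype W] →
    Strategy n X Y S W → ((S × W) × R → ℂ) → Matrix ((X × Y) × R) ((X × Y) × R) ℂ
  | _, _, _, _, _, _, _, _, _, @Strategy.done _ _ _ _ _ _ _ _ S' W' _ _ U _ V _, v => fun x y =>
      ∑ s : S', ∑ w : W', pureState (actRight V (actLeft U v))
        (((x.1.1, s), (x.1.2, w)), x.2) (((y.1.1, s), (y.1.2, w)), y.2)
  | _, _, _, _, _, _, _, _, _, @Strategy.send _ _ _ _ _ _ _ _ _ _ _ _ _ U _ rest, v => fun x y =>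
      rest.output (handOver (actLeft U v)) (x.1.swap, x.2) (y.1.swap, y.2)

/-- A protocol with `M` messages: a pure state `ψ` shared by Alice and Bob on arbitrary finite
registers `TA`, `TB`, followed by `M` alternating messages, the first one from Alice. -/
structure Protocol (Ain Bin Aout Bout : Type)
    [Fintype Ain] [Fintype Bin] [Fintype Aout] [Fintype Bout] (M : ℕ) : Type 1 where
  TA : Type
  TB : Type
  [fintypeTA : Fintype TA]
  [fintypeTB : Fintype TB]
  ψ : TA × TB → ℂ
  ψ_unit : ∑ t, ‖ψ t‖ ^ 2 = 1
  run : Strategy M Aout Bout (Ain × TA) (Bin × TB)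

attribute [instance] Protocol.fintypeTA Protocol.fintypeTB

variable {Ain Bin Aout Bout R : Type}
  [Fintype Ain] [Fintype Bin] [Fintype Aout] [Fintype Bout] [Fintype R] {M : ℕ}

/-- The joint state `φ^{Ain Bin R} ⊗ ψ^{TA TB}` at the outset, arranged by owner. -/
def Protocol.start (P : Protocol Ain Bin Aout Bout M) (φ : (Ain × Bin) × R → ℂ) :
    ((Ain × P.TA) × (Bin × P.TB)) × R → ℂ :=
  fun x => φ ((x.1.1.1, x.1.2.1), x.2) * P.ψ (x.1.1.2, x.1.2.2)

/-- The state of `Aout ⊗ Bout ⊗ R` at the end of the protocol. -/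
noncomputable def Protocol.output (P : Protocol Ain Bin Aout Bout M) (φ : (Ain × Bin) × R → ℂ) :
    Matrix ((Aout × Bout) × R) ((Aout × Bout) × R) ℂ :=
  P.run.output (P.start φ)

/-- The quantum information cost of the protocol on the input with purification `φ`. -/
noncomputable def Protocol.QIC (P : Protocol Ain Bin Aout Bout M) (φ : (Ain × Bin) × R → ℂ) : ℝ :=
  P.run.cost (P.start φ)

/-- The `M`-message protocols implementing `N` with error at most `ε` on the input with
purification `φ`. -/
def protocolsWithError
    (N : Matrix (Ain × Bin) (Ain × Bin) ℂ →ₗ[ℂ] Matrix (Aout × Bout) (Aout × Bout) ℂ)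
    (φ : (Ain × Bin) × R → ℂ) (ε : ℝ) (M : ℕ) : Set (Protocol Ain Bin Aout Bout M) :=
  {P | traceDist (P.output φ) (withRef N R (pureState φ)) ≤ ε}

/-- `M`-message, `ε`-error quantum information complexity (`⊤` if there is no such protocol). -/
noncomputable def boundedQIC (M : ℕ)
    (N : Matrix (Ain × Bin) (Ain × Bin) ℂ →ₗ[ℂ] Matrix (Aout × Bout) (Aout × Bout) ℂ)
    (φ : (Ain × Bin) × R → ℂ) (ε : ℝ) : EReal :=
  ⨅ P ∈ protocolsWithError N φ ε M, ((P.QIC φ : ℝ) : EReal)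

/-- `ε`-error quantum information complexity: the infimum over protocols with any number of
messages. -/
noncomputable def QIC
    (N : Matrix (Ain × Bin) (Ain × Bin) ℂ →ₗ[ℂ] Matrix (Aout × Bout) (Aout × Bout) ℂ)
    (φ : (Ain × Bin) × R → ℂ) (ε : ℝ) : EReal :=
  ⨅ (M : ℕ) (P ∈ protocolsWithError N φ ε M), ((P.QIC φ : ℝ) : EReal)

end QInfo

/-! Two protocols with the same number of messages are run side by side, in superposition. Each
party gets half of the shared state `√p |11⟩ + √(1-p) |00⟩`, half of a dummy input, and its shares
of both entangled states. Controlled on this bit, the real input goes to one protocol and the dummy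
to the other; at the end a controlled swap brings the real output to the front. Shorter protocols
are padded with one-dimensional messages, which carry no information.

While a message is in transit, the sender's control bit is traced out. It always agrees with the
receiver's bit, so the state of message, reference and receiver is the block diagonal mixture `p (ρ₁
⊗ σ₂) ⊕ (1-p) (ρ₂ ⊗ σ₁)`, where `σᵢ` comes from the dummy run. The receiver holds the block label,
so the entropy of the weights cancels; the dummy runs are uncorrelated with the reference, so their
entropies cancel too. Hence each conditional mutual information is the exact convex combination
(`condMutualInfo_transitMix`), and so is the whole cost (`Strategy.exists_mix`). Discarding the
control bits also makes the output the exact mixture (`reduced_mix`), and the error bound is then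
convexity of the trace distance (`traceDist_convex`).

Passing to infima in the extended reals needs costs bounded below, so that `⊤ + ⊥` cannot occur.
This is the role of strong subadditivity (`condMutualInfo_nonneg`). Since `H(A|B)` is minus the
relative entropy of `ρ` to `1 ⊗ ρ^B`, it amounts to monotonicity of relative entropy under a partial
trace. A variational formula for a resolvent version of relative entropy makes that monotonicity
evident, and integration over the parameter gives the logarithms. -/

namespace QInfo

open scoped ComplexOrder Matrix Kronecker

/-! ### Spectral decompositions -/

/-- `A = U diag(p) U†` with `U` unitary and `p` real. -/
structure SpectralDecomp {n : Type} [Fintype n] [DecidableEq n] (A U : Matrix n n ℂ) (p : n → ℝ) :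
    Prop where
  star_mul_self : Uᴴ * U = 1
  eq : A = U * Matrix.diagonal (fun i => (p i : ℂ)) * Uᴴ

section Spectral

variable {m n : Type} [Fintype m] [Fintype n] [DecidableEq m] [DecidableEq n]

theorem exists_spectralDecomp {A : Matrix n n ℂ} (hA : A.IsHermitian) :
    ∃ U p, SpectralDecomp A U p := by
  refine ⟨hA.eigenvectorUnitary, hA.eigenvalues, ?_, ?_⟩
  · exact Unitary.coe_star_mul_self hA.eigenvectorUnitary
  · exact hA.spectral_theorem

namespace SpectralDecomp

variable {A U : Matrix n n ℂ} {p : n → ℝ}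

theorem self_mul_star (h : SpectralDecomp A U p) : U * Uᴴ = 1 :=
  mul_eq_one_comm.mp h.star_mul_self

theorem conj_eq (h : SpectralDecomp A U p) :
    Uᴴ * A * U = Matrix.diagonal (fun i => (p i : ℂ)) := by
  rw [h.eq, ← Matrix.mul_assoc, ← Matrix.mul_assoc, h.star_mul_self, Matrix.one_mul,
    Matrix.mul_assoc, h.star_mul_self, Matrix.mul_one]

theorem nonneg (h : SpectralDecomp A U p) (hA : A.PosSemidef) (i : n) : 0 ≤ p i := by
  have h1 := (hA.conjTranspose_mul_mul_same U).diag_nonneg (i := i)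
  rw [h.conj_eq, Matrix.diagonal_apply_eq] at h1
  exact_mod_cast h1

/-- Entropy and trace distance are defined through these roots, so any unitary diagonalization may
be used to compute them. -/
theorem roots_charpoly (h : SpectralDecomp A U p) :
    A.charpoly.roots = Finset.univ.val.map fun i => (p i : ℂ) := by
  rw [h.eq, Matrix.charpoly_mul_comm, ← Matrix.mul_assoc, h.star_mul_self, Matrix.one_mul,
    Matrix.charpoly_diagonal, Polynomial.roots_prod _ _ (Finset.prod_ne_zero_iff.mpr
      fun i _ => Polynomial.X_sub_C_ne_zero _)]
  simp [Multiset.bind_singleton]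

theorem trace_eq (h : SpectralDecomp A U p) : A.trace = ∑ i, (p i : ℂ) := by
  rw [h.eq, Matrix.trace_mul_comm, ← Matrix.mul_assoc, h.star_mul_self, Matrix.one_mul,
    Matrix.trace_diagonal]

theorem entropy_eq (h : SpectralDecomp A U p) :
    entropy A = (∑ i, Real.negMulLog (p i)) / Real.log 2 := by
  have h1 : entropy A = (A.charpoly.roots.map fun z => -(z.re * Real.logb 2 z.re)).sum := by
    unfold entropy
    congr!
  rw [h1, h.roots_charpoly, Multiset.map_map, Finset.sum_div]
  refine Finset.sum_congr rfl fun i _ => ?_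
  simp only [Function.comp, Complex.ofReal_re, Real.logb, Real.negMulLog]
  ring

theorem traceDist_eq {ρ σ : Matrix n n ℂ} (h : SpectralDecomp (ρ - σ) U p) :
    traceDist ρ σ = ∑ i, |p i| := by
  have h1 : traceDist ρ σ = ((ρ - σ).charpoly.roots.map fun z => ‖z‖).sum := by
    unfold traceDist
    congr!
  rw [h1, h.roots_charpoly, Multiset.map_map]
  exact Finset.sum_congr rfl fun i _ => by simp

theorem smul (h : SpectralDecomp A U p) (a : ℝ) :
    SpectralDecomp ((a : ℂ) • A) U (fun i => a * p i) := by
  refine ⟨h.star_mul_self, ?_⟩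
  have h1 : Matrix.diagonal (fun i => ((a * p i : ℝ) : ℂ))
      = (a : ℂ) • Matrix.diagonal (fun i => (p i : ℂ)) := by
    ext i j
    simp [Matrix.diagonal_apply]
  rw [h1, Matrix.mul_smul, Matrix.smul_mul, ← h.eq]

theorem kronecker (h : SpectralDecomp A U p) {B V : Matrix m m ℂ} {q : m → ℝ}
    (h' : SpectralDecomp B V q) :
    SpectralDecomp (A ⊗ₖ B) (U ⊗ₖ V) (fun x => p x.1 * q x.2) := by
  refine ⟨?_, ?_⟩
  · rw [Matrix.conjTranspose_kronecker, ← Matrix.mul_kronecker_mul, h.star_mul_self,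
      h'.star_mul_self, Matrix.one_kronecker_one]
  · have h1 : Matrix.diagonal (fun x : n × m => ((p x.1 * q x.2 : ℝ) : ℂ))
        = Matrix.diagonal (fun i => (p i : ℂ)) ⊗ₖ Matrix.diagonal (fun i => (q i : ℂ)) := by
      rw [Matrix.diagonal_kronecker_diagonal]
      simp
    rw [h1, Matrix.conjTranspose_kronecker, ← Matrix.mul_kronecker_mul,
      ← Matrix.mul_kronecker_mul, ← h.eq, ← h'.eq]

end SpectralDecomp

end Spectral

/-! ### Entropies of reindexed, block diagonal and product operators -/

section Entropy

variable {m n : Type} [Fintype m] [Fintype n]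

theorem entropy_submatrix (e : m ≃ n) (A : Matrix n n ℂ) :
    entropy (A.submatrix e e) = entropy A := by
  classical
  unfold entropy
  congr 2
  have := Matrix.charpoly_reindex e.symm A
  rw [Matrix.reindex_apply] at this
  simp only [Equiv.symm_symm] at this
  convert congrArg Polynomial.roots this

theorem entropy_fromBlocks (A : Matrix m m ℂ) (B : Matrix n n ℂ) :
    entropy (Matrix.fromBlocks A 0 0 B) = entropy A + entropy B := by
  classical
  have h := congrArg Polynomial.roots (Matrix.charpoly_fromBlocks_zero₁₂ A 0 B)
  rw [Polynomial.roots_mul (mul_ne_zero (Matrix.charpoly_monic A).ne_zero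
    (Matrix.charpoly_monic B).ne_zero)] at h
  unfold entropy
  rw [← Multiset.sum_add, ← Multiset.map_add]
  congr 2
  convert h

/-- The eigenvalues are the products `a pᵢ qⱼ`, and `negMulLog` obeys a Leibniz rule on products.
Traces are kept explicit because the factors need not be normalized. -/
theorem entropy_smul_kronecker {A : Matrix m m ℂ} {B : Matrix n n ℂ} (hA : A.PosSemidef)
    (hB : B.PosSemidef) (a : ℝ) :
    entropy ((a : ℂ) • A ⊗ₖ B) = a * (entropy A * B.trace.re + A.trace.re * entropy B)
      + Real.negMulLog a / Real.log 2 * (A.trace.re * B.trace.re) := by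
  classical
  obtain ⟨U, p, h⟩ := exists_spectralDecomp hA.1
  obtain ⟨V, q, h'⟩ := exists_spectralDecomp hB.1
  rw [((h.kronecker h').smul a).entropy_eq, h.entropy_eq, h'.entropy_eq, h.trace_eq, h'.trace_eq]
  simp only [Complex.re_sum, Complex.ofReal_re]
  have h1 : ∀ x : m × n, Real.negMulLog (a * (p x.1 * q x.2))
      = a * (Real.negMulLog (p x.1) * q x.2 + p x.1 * Real.negMulLog (q x.2))
        + Real.negMulLog a * (p x.1 * q x.2) := fun x => by
    rw [Real.negMulLog_mul, Real.negMulLog_mul]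
    ring
  simp only [h1, Finset.sum_add_distrib, ← Finset.mul_sum, Fintype.sum_prod_type,
    ← Finset.sum_mul]
  ring

end Entropy

/-! ### Partial traces -/

section PartialTrace

variable {A B C : Type}

theorem trLeft_posSemidef [Fintype A] [Fintype B] {ρ : Matrix (A × B) (A × B) ℂ}
    (h : ρ.PosSemidef) : (trLeft ρ).PosSemidef := by
  have : trLeft ρ = ∑ a, ρ.submatrix (fun b => (a, b)) (fun b => (a, b)) := by
    ext
    simp [trLeft, Matrix.sum_apply]
  rw [this]
  exact Matrix.posSemidef_sum _ fun a _ => h.submatrix _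

theorem trMid_posSemidef [Fintype A] [Fintype B] [Fintype C]
    {ρ : Matrix (A × B × C) (A × B × C) ℂ}
    (h : ρ.PosSemidef) : (trMid ρ).PosSemidef := by
  have : trMid ρ = ∑ b, ρ.submatrix (fun x : A × C => (x.1, b, x.2)) (fun x => (x.1, b, x.2)) := by
    ext
    simp [trMid, Matrix.sum_apply]
  rw [this]
  exact Matrix.posSemidef_sum _ fun a _ => h.submatrix _

theorem trace_trLeft [Fintype A] [Fintype B] (ρ : Matrix (A × B) (A × B) ℂ) :
    (trLeft ρ).trace = ρ.trace := by
  simp only [Matrix.trace, trLeft, Matrix.diag, Fintype.sum_prod_type]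
  exact Finset.sum_comm

theorem trace_trMid [Fintype A] [Fintype B] [Fintype C] (ρ : Matrix (A × B × C) (A × B × C) ℂ) :
    (trMid ρ).trace = ρ.trace := by
  simp only [Matrix.trace, trMid, Matrix.diag, Fintype.sum_prod_type]
  exact Finset.sum_congr rfl fun _ _ => Finset.sum_comm

theorem trLeft_trMid [Fintype A] [Fintype B] [Fintype C] (ρ : Matrix (A × B × C) (A × B × C) ℂ) :
    trLeft (trMid ρ) = trLeft (trLeft ρ) := by
  ext
  simp only [trMid, trLeft]
  exact Finset.sum_comm

end PartialTrace

/-! ### Strong subadditivity -/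

/-! ### Integrating resolvents to logarithms -/

section RealAnalysis

open Filter Topology

variable {ι : Type} [Fintype ι] {w p q : ι → ℝ}

/-- `h0` removes exactly the terms whose logarithm would diverge as `t` tends to `0`. -/
theorem continuousOn_sum_log (hp : ∀ i, 0 ≤ p i) (hq : ∀ i, 0 ≤ q i)
    (h0 : ∀ i, q i = 0 → w i * p i = 0) :
    ContinuousOn (fun t => ∑ i, w i * p i * Real.log (q i + t * p i)) (Set.Ici 0) := by
  refine continuousOn_finsetSum _ fun i _ => ?_
  rcases (hq i).eq_or_lt with h | h
  · simp only [h0 i h.symm, zero_mul]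
    exact continuousOn_const
  · refine continuousOn_const.mul (ContinuousOn.log (by fun_prop) fun t ht => ?_)
    have := mul_nonneg (Set.mem_Ici.mp ht) (hp i)
    positivity

theorem hasDerivAt_sum_log (hp : ∀ i, 0 ≤ p i) (hq : ∀ i, 0 ≤ q i) {t : ℝ} (ht : 0 < t) :
    HasDerivAt (fun t => ∑ i, w i * p i * Real.log (q i + t * p i))
      (∑ i, w i * (p i ^ 2 / (q i + t * p i))) t := by
  refine HasDerivAt.fun_sum fun i _ => ?_
  rcases (hp i).eq_or_lt with h | h
  · simp only [← h, mul_zero, zero_mul]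
    simpa using hasDerivAt_const t (0 : ℝ)
  · have h1 : q i + t * p i ≠ 0 := by
      have := hq i
      positivity
    have h2 : HasDerivAt (fun t => q i + t * p i) (p i) t := by
      simpa using ((hasDerivAt_id t).mul_const (p i)).const_add (q i)
    exact ((h2.log h1).const_mul (w i * p i)).congr_deriv (by ring)

/-- Write `log (q + t p) = log (q / t + p) + log t`. The subtracted `log t` depends only on the
total mass `∑ w p`, so it drops out when two families of equal mass are compared. -/
theorem tendsto_sum_log (hp : ∀ i, 0 ≤ p i) (hq : ∀ i, 0 ≤ q i) :
    Tendsto (fun t => ∑ i, w i * p i * Real.log (q i + t * p i)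
      - (∑ i, w i * p i) * Real.log t) atTop (𝓝 (∑ i, w i * p i * Real.log (p i))) := by
  have h1 : ∀ i, Tendsto (fun t => w i * p i * Real.log (q i / t + p i)) atTop
      (𝓝 (w i * p i * Real.log (p i))) := fun i => by
    rcases (hp i).eq_or_lt with h | h
    · simp [← h]
    · refine Tendsto.const_mul _ (Tendsto.log ?_ h.ne')
      simpa using (tendsto_const_nhds (x := q i)).div_atTop tendsto_id |>.add_const (p i)
  refine (tendsto_finsetSum _ fun i _ => h1 i).congr' ?_
  filter_upwards [eventually_gt_atTop 0] with t ht
  rw [Finset.sum_mul, ← Finset.sum_sub_distrib]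
  refine Finset.sum_congr rfl fun i _ => ?_
  rcases (hp i).eq_or_lt with h | h
  · simp [← h]
  · have h2 : q i + t * p i = (q i / t + p i) * t := by
      field_simp
    have h3 : q i / t + p i ≠ 0 := by
      have := hq i
      positivity
    rw [h2, Real.log_mul h3 ht.ne']
    ring

/-- An inequality between the resolvents of two pairs of spectra integrates to one between the
relative entropies. -/
theorem sum_log_sub_log_le {κ : Type} [Fintype κ] {w' p' q' : κ → ℝ}
    (hp : ∀ i, 0 ≤ p i) (hq : ∀ i, 0 ≤ q i) (h0 : ∀ i, q i = 0 → w i * p i = 0)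
    (hp' : ∀ i, 0 ≤ p' i) (hq' : ∀ i, 0 ≤ q' i) (h0' : ∀ i, q' i = 0 → w' i * p' i = 0)
    (hsum : ∑ i, w i * p i = ∑ i, w' i * p' i)
    (hle : ∀ t > 0, ∑ i, w' i * (p' i ^ 2 / (q' i + t * p' i))
      ≤ ∑ i, w i * (p i ^ 2 / (q i + t * p i))) :
    ∑ i, w' i * p' i * (Real.log (p' i) - Real.log (q' i))
      ≤ ∑ i, w i * p i * (Real.log (p i) - Real.log (q i)) := by
  set Φ := fun t => ∑ i, w i * p i * Real.log (q i + t * p i) with hΦ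
  set Ψ := fun t => ∑ i, w' i * p' i * Real.log (q' i + t * p' i) with hΨ
  have hmono : MonotoneOn (fun t => Φ t - Ψ t) (Set.Ici 0) := by
    refine monotoneOn_of_hasDerivWithinAt_nonneg (convex_Ici 0)
      (f' := fun t => (∑ i, w i * (p i ^ 2 / (q i + t * p i)))
        - ∑ i, w' i * (p' i ^ 2 / (q' i + t * p' i)))
      ((continuousOn_sum_log hp hq h0).sub (continuousOn_sum_log hp' hq' h0')) ?_ ?_
    · intro t ht
      rw [interior_Ici] at ht
      exact ((hasDerivAt_sum_log hp hq ht).sub (hasDerivAt_sum_log hp' hq' ht)).hasDerivWithinAt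
    · intro t ht
      rw [interior_Ici] at ht
      exact sub_nonneg.mpr (hle t ht)
  have hlim := (tendsto_sum_log (w := w) hp hq).sub (tendsto_sum_log (w := w') hp' hq')
  have h1 : Φ 0 - Ψ 0
      ≤ ∑ i, w i * p i * Real.log (p i) - ∑ i, w' i * p' i * Real.log (p' i) := by
    refine ge_of_tendsto hlim ?_
    filter_upwards [eventually_ge_atTop 0] with t ht
    have := hmono (Set.mem_Ici.mpr le_rfl) (Set.mem_Ici.mpr ht) ht
    simp only [hΦ, hΨ] at this ⊢
    rw [hsum]
    linarith
  simp only [hΦ, hΨ, zero_mul, add_zero] at h1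
  simp only [mul_sub, Finset.sum_sub_distrib]
  linarith

/-- Completing the square: with `s = q + t p`, the claim is `|s y - p ḡ|² ≥ 0`, and equality holds
at `y = p ḡ / s`. -/
theorem two_mul_re_sub_le {p q t : ℝ} (hp : 0 ≤ p) (hq : 0 ≤ q) (ht : 0 < t) (g y : ℂ) :
    2 * (p * (g * y).re) - (q + t * p) * Complex.normSq y
      ≤ Complex.normSq g * (p ^ 2 / (q + t * p)) := by
  -- For `p = 0` the denominator may vanish, but the fraction is `0` in either case.
  rcases hp.eq_or_lt with h | h
  · subst h
    simp
    exact mul_nonneg hq (Complex.normSq_nonneg y)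
  · have hs : 0 < q + t * p := by positivity
    set s := q + t * p
    rw [← mul_div_assoc, le_div_iff₀ hs]
    have h1 := Complex.normSq_nonneg ((s : ℂ) * y - p * star g)
    simp only [Complex.normSq_apply, Complex.sub_re, Complex.sub_im, Complex.mul_re,
      Complex.mul_im, Complex.ofReal_re, Complex.ofReal_im, Complex.star_def, Complex.conj_re,
      Complex.conj_im] at h1 ⊢
    nlinarith

theorem two_mul_re_sub_eq {p q t : ℝ} (hp : 0 ≤ p) (hq : 0 ≤ q) (ht : 0 < t) (g : ℂ) :
    2 * (p * (g * ((p / (q + t * p) : ℝ) * star g)).re)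
        - (q + t * p) * Complex.normSq ((p / (q + t * p) : ℝ) * star g)
      = Complex.normSq g * (p ^ 2 / (q + t * p)) := by
  rcases hp.eq_or_lt with h | h
  · subst h
    simp
  · have hs : 0 < q + t * p := by positivity
    set s := q + t * p
    simp only [Complex.normSq_apply, Complex.mul_re,
      Complex.mul_im, Complex.ofReal_re, Complex.ofReal_im, Complex.star_def, Complex.conj_re,
      Complex.conj_im]
    field_simp
    ring

end RealAnalysis

/-! ### Variational formula for the resolvent form of relative entropy -/

section RelativeEntropy

variable {n : Type} [Fintype n]

/-- `2 Re Tr ρX - Tr X†σX - t Tr XρX†`, whose supremum over `X` is the quadratic relative modular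
form of `ρ` and `σ`. -/
def modularForm (t : ℝ) (ρ σ X : Matrix n n ℂ) : ℝ :=
  2 * (ρ * X).trace.re - (σ * (X * Xᴴ)).trace.re - t * (ρ * (Xᴴ * X)).trace.re

variable [DecidableEq n] {ρ σ U V : Matrix n n ℂ} {p q : n → ℝ}

theorem SpectralDecomp.trace_mul_conj (h : SpectralDecomp ρ U p) (Z : Matrix n n ℂ) :
    (ρ * (U * Z * Uᴴ)).trace = ∑ i, (p i : ℂ) * Z i i := by
  have h1 : ρ * (U * Z * Uᴴ)
      = U * (Matrix.diagonal (fun i => (p i : ℂ)) * Z * Uᴴ) := by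
    calc ρ * (U * Z * Uᴴ)
        = U * Matrix.diagonal (fun i => (p i : ℂ)) * (Uᴴ * U) * Z * Uᴴ := by
          conv_lhs => rw [h.eq]
          simp only [Matrix.mul_assoc]
      _ = _ := by rw [h.star_mul_self]; simp only [Matrix.mul_assoc, Matrix.one_mul]
  rw [h1, Matrix.trace_mul_comm, Matrix.mul_assoc, h.star_mul_self, Matrix.mul_one]
  simp [Matrix.trace, Matrix.diagonal_mul]

/-- With rows in the eigenbasis of `σ` and columns in that of `ρ`, the form decouples into one
scalar quadratic per matrix entry, so the scalar inequality can be applied entrywise. -/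
theorem modularForm_conj (h : SpectralDecomp ρ U p) (h' : SpectralDecomp σ V q) (t : ℝ)
    (Y : Matrix n n ℂ) :
    modularForm t ρ σ (V * Y * Uᴴ) = ∑ x : n × n,
      (2 * (p x.1 * ((Uᴴ * V) x.1 x.2 * Y x.2 x.1).re)
        - (q x.2 + t * p x.1) * Complex.normSq (Y x.2 x.1)) := by
  have e1 : V * Y * Uᴴ = U * (Uᴴ * V * Y) * Uᴴ := by
    simp only [← Matrix.mul_assoc]
    rw [h.self_mul_star, Matrix.one_mul]
  have e2 : (V * Y * Uᴴ) * (V * Y * Uᴴ)ᴴ = V * (Y * Yᴴ) * Vᴴ := by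
    simp only [Matrix.conjTranspose_mul, Matrix.conjTranspose_conjTranspose]
    calc V * Y * Uᴴ * (U * (Yᴴ * Vᴴ)) = V * Y * (Uᴴ * U) * (Yᴴ * Vᴴ) := by
          simp only [Matrix.mul_assoc]
      _ = _ := by rw [h.star_mul_self]; simp only [Matrix.mul_assoc, Matrix.mul_one]
  have e3 : (V * Y * Uᴴ)ᴴ * (V * Y * Uᴴ) = U * (Yᴴ * Y) * Uᴴ := by
    simp only [Matrix.conjTranspose_mul, Matrix.conjTranspose_conjTranspose]
    calc U * (Yᴴ * Vᴴ) * (V * Y * Uᴴ) = U * Yᴴ * (Vᴴ * V) * (Y * Uᴴ) := by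
          simp only [Matrix.mul_assoc]
      _ = _ := by rw [h'.star_mul_self]; simp only [Matrix.mul_assoc, Matrix.mul_one]
  unfold modularForm
  rw [e2, e3, e1, h.trace_mul_conj, h'.trace_mul_conj, h.trace_mul_conj]
  have e4 : ∀ i, ((Yᴴ * Y) i i).re = ∑ j, Complex.normSq (Y j i) := fun i => by
    simp [Matrix.mul_apply, Complex.normSq_apply]
  have e5 : ∀ j, ((Y * Yᴴ) j j).re = ∑ i, Complex.normSq (Y j i) := fun i => by
    simp [Matrix.mul_apply, Complex.normSq_apply]
  have e6 : ∀ i, ((Uᴴ * V * Y) i i).re = ∑ j, ((Uᴴ * V) i j * Y j i).re := fun i => by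
    rw [Matrix.mul_apply, Complex.re_sum]
  simp only [Complex.re_sum, Complex.re_ofReal_mul, e4, e5, e6]
  rw [Fintype.sum_prod_type]
  simp only [Finset.sum_sub_distrib, add_mul, Finset.sum_add_distrib, Finset.mul_sum]
  rw [Finset.sum_comm (f := fun j i => q j * Complex.normSq (Y j i))]
  simp only [mul_assoc]
  ring

theorem modularForm_le (h : SpectralDecomp ρ U p) (h' : SpectralDecomp σ V q)
    (hp : ∀ i, 0 ≤ p i) (hq : ∀ i, 0 ≤ q i) {t : ℝ} (ht : 0 < t) (X : Matrix n n ℂ) :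
    modularForm t ρ σ X ≤ ∑ x : n × n, Complex.normSq ((Uᴴ * V) x.1 x.2)
      * (p x.1 ^ 2 / (q x.2 + t * p x.1)) := by
  have e : X = V * (Vᴴ * X * U) * Uᴴ := by
    simp only [← Matrix.mul_assoc]
    rw [h'.self_mul_star, Matrix.one_mul, Matrix.mul_assoc, h.self_mul_star, Matrix.mul_one]
  rw [e, modularForm_conj h h']
  exact Finset.sum_le_sum fun x _ => two_mul_re_sub_le (hp _) (hq _) ht _ _

theorem exists_modularForm_eq (h : SpectralDecomp ρ U p) (h' : SpectralDecomp σ V q)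
    (hp : ∀ i, 0 ≤ p i) (hq : ∀ i, 0 ≤ q i) {t : ℝ} (ht : 0 < t) :
    ∃ X, modularForm t ρ σ X = ∑ x : n × n, Complex.normSq ((Uᴴ * V) x.1 x.2)
      * (p x.1 ^ 2 / (q x.2 + t * p x.1)) := by
  refine ⟨V * (Matrix.of fun j i => ((p i / (q j + t * p i) : ℝ) : ℂ) * star ((Uᴴ * V) i j)) * Uᴴ,
    ?_⟩
  rw [modularForm_conj h h']
  exact Finset.sum_congr rfl fun x _ => two_mul_re_sub_eq (hp _) (hq _) ht _

theorem sum_normSq_star_mul (h : SpectralDecomp ρ U p) (h' : SpectralDecomp σ V q) (i : n) :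
    ∑ j, Complex.normSq ((Uᴴ * V) i j) = 1 := by
  have h1 : (Uᴴ * V) * (Uᴴ * V)ᴴ = 1 := by
    rw [Matrix.conjTranspose_mul, Matrix.conjTranspose_conjTranspose]
    calc Uᴴ * V * (Vᴴ * U) = Uᴴ * (V * Vᴴ) * U := by simp only [Matrix.mul_assoc]
      _ = 1 := by rw [h'.self_mul_star, Matrix.mul_one, h.star_mul_self]
  have h2 := congrArg Complex.re (congrFun (congrFun h1 i) i)
  rw [Matrix.mul_apply, Complex.re_sum] at h2
  simpa [Complex.normSq_apply] using h2

/-- The diagonal of `ρ` in another orthonormal basis averages its eigenvalues with the squared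
overlaps as weights. Both the entropy and the trace distance arguments rest on this. -/
theorem sum_normSq_star_mul_mul (h : SpectralDecomp ρ U p) (V : Matrix n n ℂ) (j : n) :
    ∑ i, Complex.normSq ((Uᴴ * V) i j) * p i = ((Vᴴ * ρ * V) j j).re := by
  have h1 : Vᴴ * ρ * V = (Uᴴ * V)ᴴ * (Matrix.diagonal (fun i => (p i : ℂ)) * (Uᴴ * V)) := by
    conv_lhs => rw [h.eq]
    rw [Matrix.conjTranspose_mul, Matrix.conjTranspose_conjTranspose]
    simp only [Matrix.mul_assoc]
  rw [h1, Matrix.mul_apply, Complex.re_sum]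
  refine Finset.sum_congr rfl fun i _ => ?_
  rw [Matrix.diagonal_mul, Matrix.conjTranspose_apply]
  simp only [Complex.star_def, Complex.normSq_apply, Complex.mul_re, Complex.mul_im,
    Complex.conj_re, Complex.conj_im, Complex.ofReal_re, Complex.ofReal_im]
  ring

theorem sum_normSq_mul_log (h : SpectralDecomp ρ U p) (h' : SpectralDecomp σ V q) :
    ∑ x : n × n, Complex.normSq ((Uᴴ * V) x.1 x.2) * p x.1 * (Real.log (p x.1) - Real.log (q x.2))
      = ∑ i, p i * Real.log (p i) - ∑ j, ((Vᴴ * ρ * V) j j).re * Real.log (q j) := by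
  simp only [mul_sub, Finset.sum_sub_distrib, Fintype.sum_prod_type]
  congr 1
  · refine Finset.sum_congr rfl fun i _ => ?_
    rw [← one_mul (p i * _), ← sum_normSq_star_mul h h' i, Finset.sum_mul]
    exact Finset.sum_congr rfl fun j _ => by ring
  · rw [Finset.sum_comm]
    refine Finset.sum_congr rfl fun j _ => ?_
    rw [← sum_normSq_star_mul_mul h V j, Finset.sum_mul]

end RelativeEntropy

/-! ### Conditional entropy as a relative entropy -/

section Marginal

theorem sum_one_kronecker_conj {A B : Type} [Fintype A] [Fintype B] [DecidableEq A]
    (τ : Matrix (A × B) (A × B) ℂ) (V : Matrix B B ℂ) (b : B) :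
    ∑ a, (((1 : Matrix A A ℂ) ⊗ₖ V)ᴴ * τ * ((1 : Matrix A A ℂ) ⊗ₖ V)) (a, b) (a, b)
      = (Vᴴ * trLeft τ * V) b b := by
  simp only [Matrix.mul_apply, Matrix.conjTranspose_apply, Matrix.kroneckerMap_apply,
    Fintype.sum_prod_type, Matrix.one_apply, trLeft, ite_mul, one_mul, zero_mul, mul_ite, mul_zero,
    Finset.sum_ite_irrel, Finset.sum_const_zero, Finset.sum_ite_eq',
    Finset.mem_univ, if_true, apply_ite star, star_zero, Finset.sum_mul, Finset.mul_sum]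
  rw [Finset.sum_comm]
  exact Finset.sum_congr rfl fun _ _ => Finset.sum_comm

variable {A B : Type} [Fintype A] [Fintype B] [DecidableEq A] [DecidableEq B]
  {τ : Matrix (A × B) (A × B) ℂ} {V : Matrix B B ℂ} {q : B → ℝ}

theorem one_kronecker_decomp (h : SpectralDecomp (trLeft τ) V q) :
    SpectralDecomp ((1 : Matrix A A ℂ) ⊗ₖ trLeft τ) ((1 : Matrix A A ℂ) ⊗ₖ V) (fun x => q x.2) := by
  have h1 : SpectralDecomp (1 : Matrix A A ℂ) 1 (fun _ => 1) := ⟨by simp, by simp⟩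
  simpa using h1.kronecker h

theorem marginal_conj_diag (h : SpectralDecomp (trLeft τ) V q) (b : B) :
    ∑ a, ((((1 : Matrix A A ℂ) ⊗ₖ V)ᴴ * τ * ((1 : Matrix A A ℂ) ⊗ₖ V)) (a, b) (a, b)).re
      = q b := by
  rw [← Complex.re_sum, sum_one_kronecker_conj, h.conj_eq]
  simp

variable {U : Matrix (A × B) (A × B) ℂ} {p : A × B → ℝ}

/-- The diagonal entries of `τ` above a null vector of the marginal are nonnegative and sum to `q =
0`, so all vanish; each is in turn a sum of the nonnegative terms in question. -/
theorem marginal_support (hτ : τ.PosSemidef) (h : SpectralDecomp τ U p)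
    (h' : SpectralDecomp (trLeft τ) V q) (x y : A × B) (hy : q y.2 = 0) :
    Complex.normSq ((Uᴴ * ((1 : Matrix A A ℂ) ⊗ₖ V)) x y) * p x = 0 := by
  have h1 := marginal_conj_diag h' y.2
  rw [hy, Finset.sum_eq_zero_iff_of_nonneg] at h1
  · have h2 := h1 y.1 (Finset.mem_univ _)
    rw [← sum_normSq_star_mul_mul h, Finset.sum_eq_zero_iff_of_nonneg] at h2
    · exact h2 x (Finset.mem_univ _)
    · exact fun i _ => mul_nonneg (Complex.normSq_nonneg _) (h.nonneg hτ i)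
  · intro a _
    exact (Complex.le_def.mp ((hτ.conjTranspose_mul_mul_same
      ((1 : Matrix A A ℂ) ⊗ₖ V)).diag_nonneg (i := (a, y.2)))).1

/-- The sum is the relative entropy of `τ` to `1 ⊗ trLeft τ`, written through the overlaps of the
two eigenbases. -/
theorem condEntropy_eq (h : SpectralDecomp τ U p) (h' : SpectralDecomp (trLeft τ) V q) :
    condEntropy τ = -(∑ x : (A × B) × (A × B),
      Complex.normSq ((Uᴴ * ((1 : Matrix A A ℂ) ⊗ₖ V)) x.1 x.2) * p x.1
        * (Real.log (p x.1) - Real.log (q x.2.2))) / Real.log 2 := by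
  rw [sum_normSq_mul_log h (one_kronecker_decomp h'), condEntropy, h.entropy_eq, h'.entropy_eq,
    Fintype.sum_prod_type (f := fun j => Complex.re _ * _), Finset.sum_comm]
  simp only [← Finset.sum_mul, marginal_conj_diag h']
  simp only [Real.negMulLog, neg_mul, Finset.sum_neg_distrib]
  ring

end Marginal

/-! ### Monotonicity under the partial trace -/

section StrongSubadditivity

/-- `X ⊗ 1_B`, with `B` in the middle. -/
def midExtend {A B C : Type} [DecidableEq B] (X : Matrix (A × C) (A × C) ℂ) :
    Matrix (A × B × C) (A × B × C) ℂ :=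
  fun x y => if x.2.1 = y.2.1 then X (x.1, x.2.2) (y.1, y.2.2) else 0

theorem midExtend_conjTranspose {A B C : Type} [DecidableEq B] (X : Matrix (A × C) (A × C) ℂ) :
    (midExtend (B := B) X)ᴴ = midExtend Xᴴ := by
  ext ⟨a, b, c⟩ ⟨a', b', c'⟩
  by_cases h : b = b' <;> simp [midExtend, h, Ne.symm]

variable {A B C : Type} [Fintype A] [Fintype B] [Fintype C]

theorem trMid_one_kronecker [DecidableEq A] (ρ : Matrix (A × B × C) (A × B × C) ℂ) :
    trMid ((1 : Matrix A A ℂ) ⊗ₖ trLeft ρ) = (1 : Matrix A A ℂ) ⊗ₖ trLeft (trMid ρ) := by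
  ext x y
  rw [trLeft_trMid]
  simp only [trMid, Matrix.kroneckerMap_apply]
  exact (Finset.mul_sum Finset.univ (fun b => trLeft ρ (b, x.2) (b, y.2))
    ((1 : Matrix A A ℂ) x.1 y.1)).symm

variable [DecidableEq B]

theorem trace_mul_midExtend (ρ : Matrix (A × B × C) (A × B × C) ℂ)
    (X : Matrix (A × C) (A × C) ℂ) :
    (ρ * midExtend X).trace = (trMid ρ * X).trace := by
  simp only [Matrix.trace, Matrix.diag, Matrix.mul_apply, midExtend, trMid, Fintype.sum_prod_type,
    mul_ite, mul_zero, Finset.sum_ite_irrel, Finset.sum_const_zero,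
    Finset.sum_ite_eq', Finset.mem_univ, if_true, Finset.sum_mul]
  refine Finset.sum_congr rfl fun a _ => ?_
  rw [Finset.sum_comm]
  refine Finset.sum_congr rfl fun c _ => ?_
  rw [Finset.sum_comm]
  exact Finset.sum_congr rfl fun a' _ => Finset.sum_comm

theorem midExtend_mul (X Y : Matrix (A × C) (A × C) ℂ) :
    midExtend (B := B) X * midExtend Y = midExtend (X * Y) := by
  ext ⟨a, b, c⟩ ⟨a', b', c'⟩
  simp only [Matrix.mul_apply, midExtend, Fintype.sum_prod_type, mul_ite, ite_mul, mul_zero,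
    zero_mul, Finset.sum_ite_irrel, Finset.sum_const_zero, Finset.sum_ite_eq',
    Finset.mem_univ, if_true]

/-- `X ↦ X ⊗ 1` respects products and adjoints and is dual to `trMid`. Thus the variational problem
of the marginals is that of the full operators restricted to a subalgebra. -/
theorem modularForm_midExtend (t : ℝ) (ρ σ : Matrix (A × B × C) (A × B × C) ℂ)
    (X : Matrix (A × C) (A × C) ℂ) :
    modularForm t ρ σ (midExtend X) = modularForm t (trMid ρ) (trMid σ) X := by
  simp only [modularForm, midExtend_conjTranspose, midExtend_mul, trace_mul_midExtend]

end StrongSubadditivity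

/-- **Strong subadditivity** of the von Neumann entropy. -/
theorem condMutualInfo_nonneg {A B C : Type} [Fintype A] [Fintype B] [Fintype C]
    {ρ : Matrix (A × B × C) (A × B × C) ℂ} (hρ : ρ.PosSemidef) : 0 ≤ condMutualInfo ρ := by
  classical
  have hμ := trMid_posSemidef hρ
  obtain ⟨U, p, h⟩ := exists_spectralDecomp hρ.1
  obtain ⟨V, q, h'⟩ := exists_spectralDecomp (trLeft_posSemidef hρ).1
  obtain ⟨U₁, p₁, k⟩ := exists_spectralDecomp hμ.1
  obtain ⟨V₁, q₁, k'⟩ := exists_spectralDecomp (trLeft_posSemidef hμ).1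
  have hp := h.nonneg hρ
  have hq := h'.nonneg (trLeft_posSemidef hρ)
  have hp₁ := k.nonneg hμ
  have hq₁ := k'.nonneg (trLeft_posSemidef hμ)
  have H := one_kronecker_decomp h'
  have K := one_kronecker_decomp k'
  have total : ∀ {n : Type} [Fintype n] [DecidableEq n] {ρ σ U V : Matrix n n ℂ} {p q : n → ℝ},
      SpectralDecomp ρ U p → SpectralDecomp σ V q →
      ∑ x : n × n, Complex.normSq ((Uᴴ * V) x.1 x.2) * p x.1 = ρ.trace.re := by
    intro n _ _ ρ σ U V p q h h'
    simp only [Fintype.sum_prod_type, ← Finset.sum_mul, sum_normSq_star_mul h h', one_mul,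
      h.trace_eq, Complex.re_sum, Complex.ofReal_re]
  have key := sum_log_sub_log_le
    (w := fun x : (A × B × C) × (A × B × C) =>
      Complex.normSq ((Uᴴ * ((1 : Matrix A A ℂ) ⊗ₖ V)) x.1 x.2))
    (p := fun x => p x.1) (q := fun x => q x.2.2)
    (w' := fun x : (A × C) × (A × C) =>
      Complex.normSq ((U₁ᴴ * ((1 : Matrix A A ℂ) ⊗ₖ V₁)) x.1 x.2))
    (p' := fun x => p₁ x.1) (q' := fun x => q₁ x.2.2)
    (fun x => hp _) (fun x => hq _) (fun x => marginal_support hρ h h' x.1 x.2)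
    (fun x => hp₁ _) (fun x => hq₁ _) (fun x => marginal_support hμ k k' x.1 x.2)
    (by rw [total h H, total k K, trace_trMid])
    (fun t ht => by
      -- The optimal `X` for the marginals, extended by the identity, is one competitor in the
      -- supremum for `ρ` and `1 ⊗ trLeft ρ`.
      obtain ⟨X, hX⟩ := exists_modularForm_eq k K hp₁ (fun x => hq₁ _) ht
      rw [← hX, ← trMid_one_kronecker, ← modularForm_midExtend]
      exact modularForm_le h H hp (fun x => hq _) ht _)
  unfold condMutualInfo
  rw [condEntropy_eq h h', condEntropy_eq k k', ← sub_div]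
  refine div_nonneg ?_ (Real.log_nonneg (by norm_num))
  linarith

/-! ### Convexity of the trace distance -/

section TraceDistance

variable {n : Type} [Fintype n]

/-- The diagonal in the basis `V` is the image of the spectrum under a doubly stochastic matrix,
which cannot increase the `ℓ¹` norm. -/
theorem sum_abs_conj_diag_le [DecidableEq n] {X U V : Matrix n n ℂ} {p : n → ℝ}
    (h : SpectralDecomp X U p) (hV : V * Vᴴ = 1) :
    ∑ j, |((Vᴴ * X * V) j j).re| ≤ ∑ i, |p i| := by
  have h1 : SpectralDecomp (1 : Matrix n n ℂ) V (fun _ => 1) :=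
    ⟨mul_eq_one_comm.mp hV, by simp [hV]⟩
  calc ∑ j, |((Vᴴ * X * V) j j).re|
      ≤ ∑ j, ∑ i, Complex.normSq ((Uᴴ * V) i j) * |p i| := by
        refine Finset.sum_le_sum fun j _ => ?_
        rw [← sum_normSq_star_mul_mul h V j]
        refine (Finset.abs_sum_le_sum_abs _ _).trans (le_of_eq ?_)
        exact Finset.sum_congr rfl fun i _ => by
          rw [abs_mul, abs_of_nonneg (Complex.normSq_nonneg _)]
    _ = ∑ i, |p i| := by
        rw [Finset.sum_comm]
        exact Finset.sum_congr rfl fun i _ => by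
          rw [← Finset.sum_mul, sum_normSq_star_mul h h1, one_mul]

theorem traceDist_convex {ρ₁ σ₁ ρ₂ σ₂ : Matrix n n ℂ} (h₁ : (ρ₁ - σ₁).IsHermitian)
    (h₂ : (ρ₂ - σ₂).IsHermitian) {p q : ℝ} (hp : 0 ≤ p) (hq : 0 ≤ q) :
    traceDist ((p : ℂ) • ρ₁ + (q : ℂ) • ρ₂) ((p : ℂ) • σ₁ + (q : ℂ) • σ₂)
      ≤ p * traceDist ρ₁ σ₁ + q * traceDist ρ₂ σ₂ := by
  classical
  obtain ⟨U₁, s₁, k₁⟩ := exists_spectralDecomp h₁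
  obtain ⟨U₂, s₂, k₂⟩ := exists_spectralDecomp h₂
  have e : (p : ℂ) • ρ₁ + (q : ℂ) • ρ₂ - ((p : ℂ) • σ₁ + (q : ℂ) • σ₂)
      = (p : ℂ) • (ρ₁ - σ₁) + (q : ℂ) • (ρ₂ - σ₂) := by
    simp only [smul_sub]
    abel
  have hH : (((p : ℂ) • ρ₁ + (q : ℂ) • ρ₂) - ((p : ℂ) • σ₁ + (q : ℂ) • σ₂)).IsHermitian := by
    rw [e, Matrix.IsHermitian, Matrix.conjTranspose_add, Matrix.conjTranspose_smul,
      Matrix.conjTranspose_smul, h₁.eq, h₂.eq]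
    simp
  obtain ⟨V, s, k⟩ := exists_spectralDecomp hH
  rw [k.traceDist_eq, k₁.traceDist_eq, k₂.traceDist_eq]
  -- In the eigenbasis `V` of the mixture its eigenvalues are diagonal entries, which depend
  -- linearly on the two differences.
  have h3 : ∀ i, s i = p * ((Vᴴ * (ρ₁ - σ₁) * V) i i).re
      + q * ((Vᴴ * (ρ₂ - σ₂) * V) i i).re := fun i => by
    have := congrArg Complex.re (congrFun (congrFun k.conj_eq i) i)
    rw [e, Matrix.diagonal_apply_eq, Complex.ofReal_re] at this
    rw [← this]
    simp [Matrix.mul_add, Matrix.add_mul]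
  calc ∑ i, |s i| ≤ ∑ i, (p * |((Vᴴ * (ρ₁ - σ₁) * V) i i).re|
      + q * |((Vᴴ * (ρ₂ - σ₂) * V) i i).re|) := by
        refine Finset.sum_le_sum fun i _ => ?_
        rw [h3 i]
        refine (abs_add_le _ _).trans (le_of_eq ?_)
        rw [abs_mul, abs_mul, abs_of_nonneg hp, abs_of_nonneg hq]
    _ ≤ _ := by
        rw [Finset.sum_add_distrib, ← Finset.mul_sum, ← Finset.mul_sum]
        exact add_le_add
          (mul_le_mul_of_nonneg_left (sum_abs_conj_diag_le k₁ k.self_mul_star) hp)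
          (mul_le_mul_of_nonneg_left (sum_abs_conj_diag_le k₂ k.self_mul_star) hq)

end TraceDistance

/-! ### Channels applied to pure states -/

theorem IsChannel.withRef_isHermitian {A B R : Type} [Fintype A] [Fintype B] [Fintype R]
    {N : Matrix A A ℂ →ₗ[ℂ] Matrix B B ℂ} (hN : IsChannel N) {ρ : Matrix (A × R) (A × R) ℂ}
    (hρ : ρ.PosSemidef) : (withRef N R ρ).IsHermitian := by
  let e := Fintype.equivFin R
  have h := hN.completely_positive (Fintype.card R)
    (ρ.submatrix (fun x => (x.1, e.symm x.2)) (fun x => (x.1, e.symm x.2))) (hρ.submatrix _)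
  have h1 : withRef N R ρ = (withRef N (Fin (Fintype.card R))
      (ρ.submatrix (fun x => (x.1, e.symm x.2)) (fun x => (x.1, e.symm x.2)))).submatrix
      (fun x => (x.1, e x.2)) (fun x => (x.1, e x.2)) := by
    ext x y
    simp [withRef]
  rw [h1]
  exact (h.submatrix _).1

theorem withRef_add_smul {A B R : Type} (N₁ N₂ : Matrix A A ℂ →ₗ[ℂ] Matrix B B ℂ) (p q : ℂ)
    (ρ : Matrix (A × R) (A × R) ℂ) :
    withRef (p • N₁ + q • N₂) R ρ = p • withRef N₁ R ρ + q • withRef N₂ R ρ := by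
  rfl

/-! ### Unitaries and unit vectors -/

section Unitary

variable {A B C D : Type} [Fintype A] [Fintype B] [Fintype C] [Fintype D]

theorem isUnitary_iff [DecidableEq A] [DecidableEq B] {U : Matrix B A ℂ} :
    IsUnitary U ↔ Uᴴ * U = 1 ∧ U * Uᴴ = 1 := by
  unfold IsUnitary
  convert Iff.rfl

theorem isUnitary_one [DecidableEq A] : IsUnitary (1 : Matrix A A ℂ) := by
  simp [isUnitary_iff]

theorem IsUnitary.submatrix {U : Matrix B A ℂ} (hU : IsUnitary U) (e : C ≃ B) (f : D ≃ A) :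
    IsUnitary (U.submatrix e f) := by
  classical
  rw [isUnitary_iff] at hU ⊢
  rw [Matrix.conjTranspose_submatrix, Matrix.submatrix_mul_equiv, Matrix.submatrix_mul_equiv,
    hU.1, hU.2, Matrix.submatrix_one_equiv, Matrix.submatrix_one_equiv]
  exact ⟨rfl, rfl⟩

theorem IsUnitary.kronecker {U : Matrix B A ℂ} (hU : IsUnitary U) {V : Matrix D C ℂ}
    (hV : IsUnitary V) : IsUnitary (U ⊗ₖ V) := by
  classical
  rw [isUnitary_iff] at hU hV ⊢
  rw [Matrix.conjTranspose_kronecker, ← Matrix.mul_kronecker_mul, ← Matrix.mul_kronecker_mul,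
    hU.1, hU.2, hV.1, hV.2, Matrix.one_kronecker_one, Matrix.one_kronecker_one]
  exact ⟨rfl, rfl⟩

/-- Vectors of norm one. -/
def IsUnitVec (v : A → ℂ) : Prop :=
  ∑ x, v x * star (v x) = 1

theorem isUnitVec_iff {v : A → ℂ} : IsUnitVec v ↔ ∑ x, ‖v x‖ ^ 2 = 1 := by
  unfold IsUnitVec
  simp only [Complex.star_def, Complex.mul_conj, Complex.normSq_eq_norm_sq]
  norm_cast

theorem sum_mulVec_mul_star {U : Matrix B A ℂ} (hU : IsUnitary U) (v : A → ℂ) :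
    ∑ b, (∑ a, U b a * v a) * star (∑ a, U b a * v a) = ∑ a, v a * star (v a) := by
  classical
  have h1 : star (U *ᵥ v) ⬝ᵥ (U *ᵥ v) = star v ⬝ᵥ v := by
    rw [Matrix.star_mulVec, Matrix.dotProduct_mulVec, Matrix.vecMul_vecMul,
      (isUnitary_iff.mp hU).1, Matrix.vecMul_one]
  simpa [dotProduct, Matrix.mulVec, mul_comm] using h1

variable {S T W R : Type} [Fintype S] [Fintype T] [Fintype W] [Fintype R]

theorem IsUnitVec.actLeft {v : (S × W) × R → ℂ} (hv : IsUnitVec v) {U : Matrix T S ℂ}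
    (hU : IsUnitary U) : IsUnitVec (actLeft U v) := by
  rw [IsUnitVec, ← hv]
  simp only [QInfo.actLeft, Fintype.sum_prod_type]
  rw [Finset.sum_comm, Finset.sum_comm (f := fun s w => ∑ r, v ((s, w), r) * _)]
  refine Finset.sum_congr rfl fun w _ => ?_
  rw [Finset.sum_comm, Finset.sum_comm (f := fun s r => v ((s, w), r) * _)]
  exact Finset.sum_congr rfl fun r _ => sum_mulVec_mul_star hU fun s => v ((s, w), r)

theorem IsUnitVec.actRight {v : (S × W) × R → ℂ} (hv : IsUnitVec v) {U : Matrix T W ℂ}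
    (hU : IsUnitary U) : IsUnitVec (actRight U v) := by
  rw [IsUnitVec, ← hv]
  simp only [QInfo.actRight, Fintype.sum_prod_type]
  refine Finset.sum_congr rfl fun s _ => ?_
  rw [Finset.sum_comm, Finset.sum_comm (f := fun w r => v ((s, w), r) * _)]
  exact Finset.sum_congr rfl fun r _ => sum_mulVec_mul_star hU fun w => v ((s, w), r)

theorem IsUnitVec.handOver {v : ((S × C) × W) × R → ℂ} (hv : IsUnitVec v) :
    IsUnitVec (handOver v) := by
  rw [IsUnitVec, ← hv]
  exact Fintype.sum_equiv
    { toFun := fun x => (((x.1.2, x.1.1.2), x.1.1.1), x.2)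
      invFun := fun x => (((x.1.2, x.1.1.2), x.1.1.1), x.2)
      left_inv := fun _ => rfl
      right_inv := fun _ => rfl } _ _ fun _ => rfl

theorem transitState_posSemidef (v : ((S × C) × W) × R → ℂ) : (transitState v).PosSemidef := by
  have : transitState v = ∑ s, (Matrix.vecMulVec v (star v)).submatrix
      (fun x : C × R × W => (((s, x.1), x.2.2), x.2.1)) (fun x => (((s, x.1), x.2.2), x.2.1)) := by
    ext x y
    simp [transitState, pureState, Matrix.sum_apply]
  rw [this]
  exact Matrix.posSemidef_sum _ fun s _ => (Matrix.posSemidef_vecMulVec_self_star v).submatrix _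

theorem IsUnitVec.trace_transitState {v : ((S × C) × W) × R → ℂ} (hv : IsUnitVec v) :
    (transitState v).trace = 1 := by
  rw [← hv]
  simp only [Matrix.trace, Matrix.diag, transitState, pureState, Matrix.vecMulVec_apply,
    Pi.star_apply]
  rw [← Fintype.sum_prod_type' (f := fun (x : C × R × W) s => v (((s, x.1), x.2.2), x.2.1) * _)]
  exact Fintype.sum_equiv
    { toFun := fun x => (((x.2, x.1.1), x.1.2.2), x.1.2.1)
      invFun := fun x => ((x.1.1.2, x.2, x.1.2), x.1.1.1)
      left_inv := fun _ => rfl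
      right_inv := fun _ => rfl } _ _ fun _ => rfl

end Unitary

/-! ### Mutual information with a trivial register -/

section Trivial

variable {A B C : Type} [Fintype A] [Fintype B] [Fintype C]

theorem entropy_trLeft_unit (ρ : Matrix (Unit × B) (Unit × B) ℂ) :
    entropy (trLeft ρ) = entropy ρ := by
  rw [← entropy_submatrix (Equiv.punitProd B).symm ρ]
  congr 1
  ext b b'
  simp [trLeft]

theorem condMutualInfo_unit_left (ρ : Matrix (Unit × B × C) (Unit × B × C) ℂ) :
    condMutualInfo ρ = 0 := by
  simp only [condMutualInfo, condEntropy, entropy_trLeft_unit]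
  ring

theorem condMutualInfo_unit_mid (ρ : Matrix (A × Unit × C) (A × Unit × C) ℂ) :
    condMutualInfo ρ = 0 := by
  have h : entropy (trMid ρ) = entropy ρ := by
    rw [← entropy_submatrix (Equiv.prodCongr (Equiv.refl A) (Equiv.punitProd C).symm) ρ]
    congr 1
    ext b b'
    simp [trMid]
    rfl
  simp only [condMutualInfo, condEntropy, trLeft_trMid, entropy_trLeft_unit, h]
  ring

end Trivial

/-! ### Protocols with additional empty messages -/

theorem Strategy.cost_nonneg {n : ℕ} {X Y S W : Type} [Fintype X] [Fintype Y] [Fintype S]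
    [Fintype W] (st : Strategy n X Y S W) {R : Type} [Fintype R] (v : (S × W) × R → ℂ) :
    0 ≤ st.cost v := by
  induction st with
  | done => exact le_rfl
  | send S' C U hU rest ih =>
    simp only [Strategy.cost]
    exact add_nonneg (mul_nonneg (by norm_num) (condMutualInfo_nonneg (transitState_posSemidef _)))
      (ih _)

/-- The empty message is appended at the end: the active party keeps everything and sends a
one-dimensional register, so the two final unitaries follow with roles exchanged. -/
theorem Strategy.exists_succ {n : ℕ} {X Y S W : Type} [Fintype X] [Fintype Y] [Fintype S]
    [Fintype W] (st : Strategy n X Y S W) :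
    ∃ st' : Strategy (n + 1) X Y S W, ∀ {R : Type} [Fintype R] (v : (S × W) × R → ℂ),
      st'.cost v = st.cost v ∧ st'.output v = st.output v := by
  classical
  induction st with
  | @done X Y S W _ _ _ _ S' W' _ _ U hU V hV =>
    refine ⟨.send S Unit _ (isUnitary_one.submatrix (Equiv.prodPUnit S) (Equiv.refl S))
      (.done W' S' _ (hV.submatrix (Equiv.refl _) (Equiv.prodPUnit W)) U hU), fun {R} _ v =>
      ⟨?_, ?_⟩⟩
    · simp only [Strategy.cost, condMutualInfo_unit_left]
      ring
    · ext x y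
      have h : ∀ (s : S') (w : W') (z : X × Y) (r : R),
          actRight U (actLeft (V.submatrix (Equiv.refl _) (Equiv.prodPUnit W)) (handOver
            (actLeft ((1 : Matrix S S ℂ).submatrix (Equiv.prodPUnit S) (Equiv.refl S)) v)))
          (((z.2, w), (z.1, s)), r) = actRight V (actLeft U v) (((z.1, s), (z.2, w)), r) := by
        intro s w z r
        simp only [actRight, actLeft, handOver, Fintype.sum_prod_type, Matrix.submatrix_apply,
          Matrix.one_apply, Finset.mul_sum]
        rw [Finset.sum_comm]
        simp [mul_left_comm]
      simp only [Strategy.output, pureState, Matrix.vecMulVec_apply, Pi.star_apply]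
      rw [Finset.sum_comm]
      refine Finset.sum_congr rfl fun s _ => Finset.sum_congr rfl fun w _ => ?_
      rw [← h s w x.1 x.2, ← h s w y.1 y.2]
      rfl
  | send S' C U hU rest ih =>
    obtain ⟨rest', h⟩ := ih
    refine ⟨.send S' C U hU rest', fun v => ⟨?_, ?_⟩⟩
    · simp only [Strategy.cost, (h _).1]
    · simp only [Strategy.output, (h _).2]
      rfl

theorem Strategy.exists_of_le {n m : ℕ} (hnm : n ≤ m) {X Y S W : Type} [Fintype X] [Fintype Y]
    [Fintype S] [Fintype W] (st : Strategy n X Y S W) :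
    ∃ st' : Strategy m X Y S W, ∀ {R : Type} [Fintype R] (v : (S × W) × R → ℂ),
      st'.cost v = st.cost v ∧ st'.output v = st.output v := by
  induction m, hnm using Nat.le_induction with
  | base => exact ⟨st, fun v => ⟨rfl, rfl⟩⟩
  | succ m _ ih =>
    obtain ⟨st₁, h₁⟩ := ih
    obtain ⟨st₂, h₂⟩ := st₁.exists_succ
    exact ⟨st₂, fun v => ⟨(h₂ v).1.trans (h₁ v).1, (h₂ v).2.trans (h₁ v).2⟩⟩

theorem Protocol.exists_of_le {n m : ℕ} (hnm : n ≤ m) {Ain Bin Aout Bout : Type}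
    [Fintype Ain] [Fintype Bin] [Fintype Aout] [Fintype Bout]
    (P : Protocol Ain Bin Aout Bout n) :
    ∃ P' : Protocol Ain Bin Aout Bout m, ∀ {R : Type} [Fintype R] (φ : (Ain × Bin) × R → ℂ),
      P'.QIC φ = P.QIC φ ∧ P'.output φ = P.output φ := by
  obtain ⟨st, h⟩ := P.run.exists_of_le hnm
  exact ⟨⟨P.TA, P.TB, P.ψ, P.ψ_unit, st⟩, fun φ => h _⟩

/-! ### Entropies of classical-quantum mixtures of product states -/

section Mixture

variable {Z K Z₁ Z₂ V₁ V₂ : Type}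

/-- The block diagonal operator `a (ρ₁ ⊗ σ₂) ⊕ b (ρ₂ ⊗ σ₁)`, where the identification of the index
sets is given by `e`, `e₁` and `e₂`. -/
def cqMix (e : Z ≃ Bool × K) (e₁ : K ≃ Z₁ × V₂) (e₂ : K ≃ Z₂ × V₁) (a b : ℝ)
    (ρ₁ : Matrix Z₁ Z₁ ℂ) (σ₂ : Matrix V₂ V₂ ℂ) (ρ₂ : Matrix Z₂ Z₂ ℂ) (σ₁ : Matrix V₁ V₁ ℂ) :
    Matrix Z Z ℂ := fun x y =>
  if (e x).1 then
    if (e y).1 then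
      a * (ρ₁ (e₁ (e x).2).1 (e₁ (e y).2).1 * σ₂ (e₁ (e x).2).2 (e₁ (e y).2).2)
    else 0
  else
    if (e y).1 then 0
    else b * (ρ₂ (e₂ (e x).2).1 (e₂ (e y).2).1 * σ₁ (e₂ (e x).2).2 (e₂ (e y).2).2)

theorem entropy_cqMix [Fintype Z] [Fintype Z₁] [Fintype Z₂] [Fintype V₁] [Fintype V₂]
    (e : Z ≃ Bool × K) (e₁ : K ≃ Z₁ × V₂) (e₂ : K ≃ Z₂ × V₁) (a b : ℝ)
    {ρ₁ : Matrix Z₁ Z₁ ℂ} {σ₂ : Matrix V₂ V₂ ℂ} {ρ₂ : Matrix Z₂ Z₂ ℂ} {σ₁ : Matrix V₁ V₁ ℂ}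
    (h₁ : ρ₁.PosSemidef) (k₂ : σ₂.PosSemidef) (h₂ : ρ₂.PosSemidef) (k₁ : σ₁.PosSemidef) :
    entropy (cqMix e e₁ e₂ a b ρ₁ σ₂ ρ₂ σ₁)
      = (a * (entropy ρ₁ * σ₂.trace.re + ρ₁.trace.re * entropy σ₂)
          + Real.negMulLog a / Real.log 2 * (ρ₁.trace.re * σ₂.trace.re))
        + (b * (entropy ρ₂ * σ₁.trace.re + ρ₂.trace.re * entropy σ₁)
          + Real.negMulLog b / Real.log 2 * (ρ₂.trace.re * σ₁.trace.re)) := by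
  -- `Equiv.boolProdEquivSum` puts `false` on the left, so the block with weight `b` must come
  -- first.
  rw [← entropy_smul_kronecker h₁ k₂, ← entropy_smul_kronecker h₂ k₁, add_comm,
    ← entropy_fromBlocks,
    ← entropy_submatrix (e.trans ((Equiv.boolProdEquivSum K).trans (Equiv.sumCongr e₂ e₁)))]
  congr 1
  ext x y
  rcases hx : e x with ⟨_ | _, k⟩ <;> rcases hy : e y with ⟨_ | _, l⟩ <;>
    simp [cqMix, hx, hy, Equiv.boolProdEquivSum, Matrix.kroneckerMap_apply]

end Mixture

/-! ### Superpositions of two runs -/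

section Superposition

variable {S T W S₁ S₂ W₁ W₂ T₁ T₂ C₁ C₂ R : Type}

/-- The superposition of two runs of two protocols, controlled by a qubit on either side: with
amplitude `a` the first run is on the proper input and leads to `v₁`, while the second one is on a
dummy input and leads to `u₂`; with amplitude `b` it is the other way round. -/
def mix (f : S → Bool × S₁ × S₂) (g : W → Bool × W₁ × W₂) (a b : ℝ)
    (v₁ : (S₁ × W₁) × R → ℂ) (u₁ : (S₁ × W₁) × Unit → ℂ)
    (v₂ : (S₂ × W₂) × R → ℂ) (u₂ : (S₂ × W₂) × Unit → ℂ) : (S × W) × R → ℂ := fun x =>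
  if (f x.1.1).1 then
    if (g x.1.2).1 then
      a * (v₁ (((f x.1.1).2.1, (g x.1.2).2.1), x.2) * u₂ (((f x.1.1).2.2, (g x.1.2).2.2), ()))
    else 0
  else
    if (g x.1.2).1 then 0
    else b * (v₂ (((f x.1.1).2.2, (g x.1.2).2.2), x.2) * u₁ (((f x.1.1).2.1, (g x.1.2).2.1), ()))

/-- Both local unitaries side by side, leaving the control qubit alone. -/
def sideBySide (U₁ : Matrix T₁ S₁ ℂ) (U₂ : Matrix T₂ S₂ ℂ) :
    Matrix (Bool × T₁ × T₂) (Bool × S₁ × S₂) ℂ :=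
  (1 : Matrix Bool Bool ℂ) ⊗ₖ (U₁ ⊗ₖ U₂)

theorem IsUnitary.sideBySide [Fintype S₁] [Fintype S₂] [Fintype T₁] [Fintype T₂]
    {U₁ : Matrix T₁ S₁ ℂ} {U₂ : Matrix T₂ S₂ ℂ} (h₁ : IsUnitary U₁) (h₂ : IsUnitary U₂) :
    IsUnitary (sideBySide U₁ U₂) :=
  isUnitary_one.kronecker (h₁.kronecker h₂)

theorem sum_sideBySide [Fintype S] [Fintype S₁] [Fintype S₂] (e : S ≃ Bool × S₁ × S₂)
    (U₁ : Matrix T₁ S₁ ℂ) (U₂ : Matrix T₂ S₂ ℂ) (t : Bool × T₁ × T₂)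
    (h : Bool × S₁ × S₂ → ℂ) :
    ∑ s, sideBySide U₁ U₂ t (e s) * h (e s)
      = ∑ s₁, ∑ s₂, U₁ t.2.1 s₁ * U₂ t.2.2 s₂ * h (t.1, s₁, s₂) := by
  rw [e.sum_comp fun s => sideBySide U₁ U₂ t s * h s]
  obtain ⟨d, t₁, t₂⟩ := t
  simp only [sideBySide, Fintype.sum_prod_type, Matrix.kroneckerMap_apply, Matrix.one_apply]
  cases d <;> simp

theorem actLeft_mix [Fintype S] [Fintype S₁] [Fintype S₂] (f : T → Bool × T₁ × T₂)
    (e : S ≃ Bool × S₁ × S₂) (g : W → Bool × W₁ × W₂) (U₁ : Matrix T₁ S₁ ℂ)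
    (U₂ : Matrix T₂ S₂ ℂ) (a b : ℝ)
    (v₁ : (S₁ × W₁) × R → ℂ) (u₁ : (S₁ × W₁) × Unit → ℂ)
    (v₂ : (S₂ × W₂) × R → ℂ) (u₂ : (S₂ × W₂) × Unit → ℂ) :
    actLeft ((sideBySide U₁ U₂).submatrix f e) (mix e g a b v₁ u₁ v₂ u₂)
      = mix f g a b (actLeft U₁ v₁) (actLeft U₁ u₁) (actLeft U₂ v₂) (actLeft U₂ u₂) := by
  ext ⟨⟨t, w⟩, r⟩
  -- With `id` in place of `e`, the vector is a function on `Bool × S₁ × S₂` evaluated at `e s`, as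
  -- `sum_sideBySide` requires.
  refine (sum_sideBySide e U₁ U₂ (f t) fun s => mix id g a b v₁ u₁ v₂ u₂ ((s, w), r)).trans ?_
  simp only [mix, actLeft, id]
  split_ifs
  · rw [Finset.sum_mul_sum, Finset.mul_sum]
    refine Finset.sum_congr rfl fun s _ => ?_
    rw [Finset.mul_sum]
    exact Finset.sum_congr rfl fun s _ => by ring
  · simp
  · simp
  · rw [Finset.sum_mul_sum, Finset.mul_sum, Finset.sum_comm]
    refine Finset.sum_congr rfl fun s _ => ?_
    rw [Finset.mul_sum]
    exact Finset.sum_congr rfl fun s _ => by ring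

theorem actRight_mix [Fintype W] [Fintype W₁] [Fintype W₂] (g : T → Bool × T₁ × T₂)
    (e : W ≃ Bool × W₁ × W₂) (f : S → Bool × S₁ × S₂) (V₁ : Matrix T₁ W₁ ℂ)
    (V₂ : Matrix T₂ W₂ ℂ) (a b : ℝ)
    (v₁ : (S₁ × W₁) × R → ℂ) (u₁ : (S₁ × W₁) × Unit → ℂ)
    (v₂ : (S₂ × W₂) × R → ℂ) (u₂ : (S₂ × W₂) × Unit → ℂ) :
    actRight ((sideBySide V₁ V₂).submatrix g e) (mix f e a b v₁ u₁ v₂ u₂)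
      = mix f g a b (actRight V₁ v₁) (actRight V₁ u₁) (actRight V₂ v₂) (actRight V₂ u₂) := by
  ext ⟨⟨s, t⟩, r⟩
  refine (sum_sideBySide e V₁ V₂ (g t) fun w => mix f id a b v₁ u₁ v₂ u₂ ((s, w), r)).trans ?_
  simp only [mix, actRight, id]
  split_ifs
  · rw [Finset.sum_mul_sum, Finset.mul_sum]
    refine Finset.sum_congr rfl fun s _ => ?_
    rw [Finset.mul_sum]
    exact Finset.sum_congr rfl fun s _ => by ring
  · simp
  · simp
  · rw [Finset.sum_mul_sum, Finset.mul_sum, Finset.sum_comm]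
    refine Finset.sum_congr rfl fun s _ => ?_
    rw [Finset.mul_sum]
    exact Finset.sum_congr rfl fun s _ => by ring

/-- Distribution of a pair of messages over a pair of registers. -/
def pairEquiv (C₁ C₂ : Type) (g : W ≃ Bool × W₁ × W₂) :
    W × (C₁ × C₂) ≃ Bool × (W₁ × C₁) × (W₂ × C₂) where
  toFun x := ((g x.1).1, ((g x.1).2.1, x.2.1), ((g x.1).2.2, x.2.2))
  invFun x := (g.symm (x.1, x.2.1.1, x.2.2.1), (x.2.1.2, x.2.2.2))
  left_inv x := by simp
  right_inv x := by simp

theorem handOver_mix (g : W ≃ Bool × W₁ × W₂) (a b : ℝ)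
    (v₁ : ((S₁ × C₁) × W₁) × R → ℂ) (u₁ : ((S₁ × C₁) × W₁) × Unit → ℂ)
    (v₂ : ((S₂ × C₂) × W₂) × R → ℂ) (u₂ : ((S₂ × C₂) × W₂) × Unit → ℂ) :
    handOver (mix (pairEquiv C₁ C₂ (Equiv.refl _)) g a b v₁ u₁ v₂ u₂)
      = mix (pairEquiv C₁ C₂ g) (Equiv.refl _) a b
        (handOver v₁) (handOver u₁) (handOver v₂) (handOver u₂) := by
  ext ⟨⟨⟨w, c⟩, ⟨d, s⟩⟩, r⟩
  simp only [handOver, mix, pairEquiv, Equiv.coe_fn_mk, Equiv.refl_apply]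
  cases d <;> simp

end Superposition

/-! ### The information cost of a superposition -/

section Cost

variable {S₁ S₂ W W₁ W₂ C₁ C₂ R : Type}

/-- Bringing the control bit of the last register to the front. -/
def controlEquiv (C : Type) (g : W ≃ Bool × W₁ × W₂) :
    C × W ≃ Bool × (C × (W₁ × W₂)) where
  toFun x := ((g x.2).1, (x.1, (g x.2).2))
  invFun x := (x.2.1, g.symm (x.1, x.2.2))
  left_inv x := by simp
  right_inv x := by simp

/-- The mixture of `ρ₁ ⊗ σ₂` and `ρ₂ ⊗ σ₁` on a pair of messages, the reference register and the
memory of the receiver. -/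
def transitMix (g : W ≃ Bool × W₁ × W₂) (a b : ℝ)
    (ρ₁ : Matrix (C₁ × R × W₁) (C₁ × R × W₁) ℂ)
    (σ₂ : Matrix (C₂ × Unit × W₂) (C₂ × Unit × W₂) ℂ)
    (ρ₂ : Matrix (C₂ × R × W₂) (C₂ × R × W₂) ℂ)
    (σ₁ : Matrix (C₁ × Unit × W₁) (C₁ × Unit × W₁) ℂ) :
    Matrix ((C₁ × C₂) × R × W) ((C₁ × C₂) × R × W) ℂ :=
  cqMix ((Equiv.prodAssoc _ _ _).symm.trans (controlEquiv ((C₁ × C₂) × R) g))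
    { toFun := fun x => ((x.1.1.1, x.1.2, x.2.1), (x.1.1.2, (), x.2.2))
      invFun := fun x => (((x.1.1, x.2.1), x.1.2.1), (x.1.2.2, x.2.2.2))
      left_inv := fun _ => rfl
      right_inv := fun _ => rfl }
    { toFun := fun x => ((x.1.1.2, x.1.2, x.2.2), (x.1.1.1, (), x.2.1))
      invFun := fun x => (((x.2.1, x.1.1), x.1.2.1), (x.2.2.2, x.1.2.2))
      left_inv := fun _ => rfl
      right_inv := fun _ => rfl } a b ρ₁ σ₂ ρ₂ σ₁

/-- The sender's control bit is traced out with the memory and agrees with the receiver's, so no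
coherence between the branches survives; amplitudes become the weights `a²` and `b²`. -/
theorem transitState_mix [Fintype S₁] [Fintype S₂] (g : W ≃ Bool × W₁ × W₂) (a b : ℝ)
    (v₁ : ((S₁ × C₁) × W₁) × R → ℂ) (u₁ : ((S₁ × C₁) × W₁) × Unit → ℂ)
    (v₂ : ((S₂ × C₂) × W₂) × R → ℂ) (u₂ : ((S₂ × C₂) × W₂) × Unit → ℂ) :
    transitState (mix (pairEquiv C₁ C₂ (Equiv.refl _)) g a b v₁ u₁ v₂ u₂)
      = transitMix g (a ^ 2) (b ^ 2)
        (transitState v₁) (transitState u₂) (transitState v₂) (transitState u₁) := by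
  ext ⟨c, r, w⟩ ⟨c', r', w'⟩
  rcases hw : g w with ⟨_ | _, w₁, w₂⟩ <;> rcases hw' : g w' with ⟨_ | _, w₁', w₂'⟩ <;>
    simp only [transitState, pureState, Matrix.vecMulVec_apply, Pi.star_apply, transitMix, cqMix,
      mix, pairEquiv, controlEquiv, Equiv.coe_fn_mk, Equiv.trans_apply, Equiv.prodAssoc_symm_apply,
      Equiv.refl_apply, hw, hw', Fintype.sum_prod_type, Fintype.sum_bool] <;>
    simp
  · rw [Finset.sum_comm, Finset.sum_mul_sum, Finset.mul_sum]
    refine Finset.sum_congr rfl fun s _ => ?_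
    rw [Finset.mul_sum]
    exact Finset.sum_congr rfl fun s _ => by ring
  · rw [Finset.sum_mul_sum, Finset.mul_sum]
    refine Finset.sum_congr rfl fun s _ => ?_
    rw [Finset.mul_sum]
    exact Finset.sum_congr rfl fun s _ => by ring

variable (g : W ≃ Bool × W₁ × W₂) (a b : ℝ)
    (ρ₁ : Matrix (C₁ × R × W₁) (C₁ × R × W₁) ℂ)
    (σ₂ : Matrix (C₂ × Unit × W₂) (C₂ × Unit × W₂) ℂ)
    (ρ₂ : Matrix (C₂ × R × W₂) (C₂ × R × W₂) ℂ)
    (σ₁ : Matrix (C₁ × Unit × W₁) (C₁ × Unit × W₁) ℂ)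

theorem trMid_transitMix [Fintype R] :
    trMid (transitMix g a b ρ₁ σ₂ ρ₂ σ₁) = cqMix (controlEquiv (C₁ × C₂) g)
      { toFun := fun x => ((x.1.1, x.2.1), (x.1.2, x.2.2))
        invFun := fun x => ((x.1.1, x.2.1), (x.1.2, x.2.2))
        left_inv := fun _ => rfl
        right_inv := fun _ => rfl }
      { toFun := fun x => ((x.1.2, x.2.2), (x.1.1, x.2.1))
        invFun := fun x => ((x.2.1, x.1.1), (x.2.2, x.1.2))
        left_inv := fun _ => rfl
        right_inv := fun _ => rfl } a b (trMid ρ₁) (trMid σ₂) (trMid ρ₂) (trMid σ₁) := by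
  ext ⟨c, w⟩ ⟨c', w'⟩
  rcases hw : g w with ⟨_ | _, w₁, w₂⟩ <;> rcases hw' : g w' with ⟨_ | _, w₁', w₂'⟩ <;>
    simp [trMid, transitMix, cqMix, controlEquiv, hw, hw', Finset.sum_mul, Finset.mul_sum]

theorem trLeft_transitMix [Fintype C₁] [Fintype C₂] :
    trLeft (transitMix g a b ρ₁ σ₂ ρ₂ σ₁) = cqMix (controlEquiv R g)
      { toFun := fun x => ((x.1, x.2.1), ((), x.2.2))
        invFun := fun x => (x.1.1, (x.1.2, x.2.2))
        left_inv := fun _ => rfl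
        right_inv := fun _ => rfl }
      { toFun := fun x => ((x.1, x.2.2), ((), x.2.1))
        invFun := fun x => (x.1.1, (x.2.2, x.1.2))
        left_inv := fun _ => rfl
        right_inv := fun _ => rfl } a b (trLeft ρ₁) (trLeft σ₂) (trLeft ρ₂) (trLeft σ₁) := by
  ext ⟨r, w⟩ ⟨r', w'⟩
  rcases hw : g w with ⟨_ | _, w₁, w₂⟩ <;> rcases hw' : g w' with ⟨_ | _, w₁', w₂'⟩ <;>
    simp [trLeft, transitMix, cqMix, controlEquiv, hw, hw', Fintype.sum_prod_type,
      Finset.sum_mul, Finset.mul_sum]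
  exact Finset.sum_comm

theorem trLeft_trLeft_transitMix [Fintype C₁] [Fintype C₂] [Fintype R] :
    trLeft (trLeft (transitMix g a b ρ₁ σ₂ ρ₂ σ₁)) = cqMix g (Equiv.refl _) (Equiv.prodComm _ _)
      a b (trLeft (trLeft ρ₁)) (trLeft (trLeft σ₂)) (trLeft (trLeft ρ₂))
      (trLeft (trLeft σ₁)) := by
  rw [trLeft_transitMix]
  ext w w'
  rcases hw : g w with ⟨_ | _, w₁, w₂⟩ <;> rcases hw' : g w' with ⟨_ | _, w₁', w₂'⟩ <;>
    simp [trLeft, cqMix, controlEquiv, hw, hw', Finset.sum_mul, Finset.mul_sum] <;>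
    exact Finset.sum_comm

variable {ρ₁ σ₂ ρ₂ σ₁}

/-- Partial traces preserve the trace, so the `negMulLog` terms agree in all four entropies and
cancel. What the dummy states leave is their own conditional mutual information, zero because their
reference is trivial. -/
theorem condMutualInfo_transitMix [Fintype W] [Fintype W₁] [Fintype W₂] [Fintype C₁] [Fintype C₂]
    [Fintype R] (h₁ : ρ₁.PosSemidef) (k₂ : σ₂.PosSemidef) (h₂ : ρ₂.PosSemidef)
    (k₁ : σ₁.PosSemidef) (t₁ : σ₁.trace = 1) (t₂ : σ₂.trace = 1) :
    condMutualInfo (transitMix g a b ρ₁ σ₂ ρ₂ σ₁)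
      = a * condMutualInfo ρ₁ + b * condMutualInfo ρ₂ := by
  have i₁ := condMutualInfo_unit_mid σ₁
  have i₂ := condMutualInfo_unit_mid σ₂
  simp only [condMutualInfo, condEntropy, trLeft_trMid] at i₁ i₂ ⊢
  rw [trLeft_trLeft_transitMix, trLeft_transitMix, trMid_transitMix, transitMix,
    entropy_cqMix _ _ _ _ _ h₁ k₂ h₂ k₁,
    entropy_cqMix _ _ _ _ _ (trMid_posSemidef h₁) (trMid_posSemidef k₂) (trMid_posSemidef h₂)
      (trMid_posSemidef k₁),
    entropy_cqMix _ _ _ _ _ (trLeft_posSemidef h₁) (trLeft_posSemidef k₂) (trLeft_posSemidef h₂)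
      (trLeft_posSemidef k₁),
    entropy_cqMix _ _ _ _ _ (trLeft_posSemidef (trLeft_posSemidef h₁))
      (trLeft_posSemidef (trLeft_posSemidef k₂)) (trLeft_posSemidef (trLeft_posSemidef h₂))
      (trLeft_posSemidef (trLeft_posSemidef k₁))]
  simp only [trace_trLeft, trace_trMid, t₁, t₂, Complex.one_re]
  linear_combination a * ρ₁.trace.re * i₂ + b * ρ₂.trace.re * i₁

end Cost

/-! ### The output of a superposition -/

section Output

variable {X Y S₁ S₂ W₁ W₂ R : Type}

/-- The controlled exchange of two copies of a register. -/
def controlledSwap (X S₁ S₂ : Type) : X × (Bool × X × S₁ × S₂) ≃ Bool × (X × S₁) × (X × S₂) where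
  toFun z := if z.2.1 then (true, (z.1, z.2.2.2.1), (z.2.2.1, z.2.2.2.2))
    else (false, (z.2.2.1, z.2.2.2.1), (z.1, z.2.2.2.2))
  invFun z := if z.1 then (z.2.1.1, (true, z.2.2.1, z.2.1.2, z.2.2.2))
    else (z.2.2.1, (false, z.2.1.1, z.2.1.2, z.2.2.2))
  left_inv := by rintro ⟨x, ⟨_ | _, y, s, t⟩⟩ <;> rfl
  right_inv := by rintro ⟨_ | _, ⟨x, s⟩, ⟨y, t⟩⟩ <;> rfl

/-- The joint state of the outputs `X`, `Y` and the reference register. -/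
def reduced [Fintype S₁] [Fintype W₁] (v : ((X × S₁) × (Y × W₁)) × R → ℂ) :
    Matrix ((X × Y) × R) ((X × Y) × R) ℂ := fun x y =>
  ∑ s, ∑ w, pureState v (((x.1.1, s), (x.1.2, w)), x.2) (((y.1.1, s), (y.1.2, w)), y.2)

theorem reduced_isHermitian [Fintype S₁] [Fintype W₁] (v : ((X × S₁) × (Y × W₁)) × R → ℂ) :
    (reduced v).IsHermitian := by
  ext x y
  simp [reduced, pureState, Matrix.vecMulVec_apply, mul_comm]

variable [Fintype X] [Fintype Y] [Fintype S₁] [Fintype S₂] [Fintype W₁] [Fintype W₂]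

theorem sum_mul_unitVec (F : S₁ → W₁ → ℂ) {u : ((X × S₂) × (Y × W₂)) × Unit → ℂ}
    (hu : IsUnitVec u) :
    ∑ x, ∑ s, ∑ t, ∑ y, ∑ w, ∑ z,
        F s w * (u (((x, t), (y, z)), ()) * star (u (((x, t), (y, z)), ())))
      = ∑ s, ∑ w, F s w := by
  have h : ∑ x, ∑ t, ∑ y, ∑ z, u (((x, t), (y, z)), ()) * star (u (((x, t), (y, z)), ())) = 1 := by
    rw [← hu]
    simp [Fintype.sum_prod_type]
  rw [Finset.sum_comm]
  refine Finset.sum_congr rfl fun s _ => ?_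
  calc _ = ∑ x, ∑ t, ∑ w, ∑ y, ∑ z,
        F s w * (u (((x, t), (y, z)), ()) * star (u (((x, t), (y, z)), ()))) :=
        Finset.sum_congr rfl fun x _ => Finset.sum_congr rfl fun t _ => Finset.sum_comm
    _ = ∑ x, ∑ w, ∑ t, ∑ y, ∑ z,
        F s w * (u (((x, t), (y, z)), ()) * star (u (((x, t), (y, z)), ()))) :=
        Finset.sum_congr rfl fun x _ => Finset.sum_comm
    _ = ∑ w, ∑ x, ∑ t, ∑ y, ∑ z,
        F s w * (u (((x, t), (y, z)), ()) * star (u (((x, t), (y, z)), ()))) :=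
        Finset.sum_comm
    _ = _ := by
        simp only [← Finset.mul_sum, h, mul_one]

/-- Both control bits are discarded, which kills the cross terms; the discarded dummy run
contributes the squared norm of `u₂` or `u₁`, which is one. -/
theorem reduced_mix (a b : ℝ)
    (v₁ : ((X × S₁) × (Y × W₁)) × R → ℂ) {u₁ : ((X × S₁) × (Y × W₁)) × Unit → ℂ}
    (v₂ : ((X × S₂) × (Y × W₂)) × R → ℂ) {u₂ : ((X × S₂) × (Y × W₂)) × Unit → ℂ}
    (h₁ : IsUnitVec u₁) (h₂ : IsUnitVec u₂) :
    reduced (mix (controlledSwap X S₁ S₂) (controlledSwap Y W₁ W₂) a b v₁ u₁ v₂ u₂)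
      = ((a ^ 2 : ℝ) : ℂ) • reduced v₁ + ((b ^ 2 : ℝ) : ℂ) • reduced v₂ := by
  ext ⟨⟨x, y⟩, r⟩ ⟨⟨x', y'⟩, r'⟩
  have e₁ := sum_mul_unitVec (fun s w => (a ^ 2 : ℂ) *
    (v₁ (((x, s), (y, w)), r) * star (v₁ (((x', s), (y', w)), r')))) h₂
  have e₂ := sum_mul_unitVec (fun s w => (b ^ 2 : ℂ) *
    (v₂ (((x, s), (y, w)), r) * star (v₂ (((x', s), (y', w)), r')))) h₁
  simp only [reduced, pureState, Matrix.vecMulVec_apply, Pi.star_apply, Matrix.add_apply,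
    Matrix.smul_apply, smul_eq_mul, Fintype.sum_prod_type, Fintype.sum_bool, mix, controlledSwap,
    Equiv.coe_fn_mk, Finset.mul_sum]
  simp only [if_true, Bool.false_eq_true, if_false, star_zero, mul_zero, Finset.sum_const_zero,
    add_zero, zero_add, Complex.ofReal_pow]
  rw [← e₁, ← e₂]
  refine congrArg₂ (· + ·) ?_ ?_
  · refine Finset.sum_congr rfl fun _ _ => Finset.sum_congr rfl fun _ _ =>
      Finset.sum_congr rfl fun _ _ => Finset.sum_congr rfl fun _ _ =>
      Finset.sum_congr rfl fun _ _ => Finset.sum_congr rfl fun _ _ => ?_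
    simp only [star_mul', Complex.star_def, Complex.conj_ofReal]
    ring
  · refine Finset.sum_congr rfl fun x _ => ?_
    rw [Finset.sum_comm]
    refine Finset.sum_congr rfl fun _ _ => Finset.sum_congr rfl fun _ _ =>
      Finset.sum_congr rfl fun _ _ => ?_
    rw [Finset.sum_comm]
    refine Finset.sum_congr rfl fun _ _ => Finset.sum_congr rfl fun _ _ => ?_
    simp only [star_mul', Complex.star_def, Complex.conj_ofReal]
    ring

end Output

/-! ### Running two protocols in superposition -/

theorem Strategy.output_isHermitian {n : ℕ} {X Y S W : Type} [Fintype X] [Fintype Y] [Fintype S]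
    [Fintype W] (st : Strategy n X Y S W) {R : Type} [Fintype R] (v : (S × W) × R → ℂ) :
    (st.output v).IsHermitian := by
  induction st with
  | done S' W' U hU V hV => exact reduced_isHermitian (actRight V (actLeft U v))
  | send S' C U hU rest ih => exact (ih _).submatrix fun x : (_ × _) × R => (x.1.swap, x.2)

/-- The identifications `f` and `g` are arbitrary so that the induction can absorb each pair of
messages into the receiver's register. The same freedom encodes the controlled swaps of inputs and
outputs as mere relabelings of basis vectors. -/
theorem Strategy.exists_mix {n : ℕ} {X Y S₁ W₁ : Type} [Fintype X] [Fintype Y] [Fintype S₁]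
    [Fintype W₁] (st₁ : Strategy n X Y S₁ W₁) {S₂ W₂ S W : Type} [Fintype S₂] [Fintype W₂]
    [Fintype S] [Fintype W] (st₂ : Strategy n X Y S₂ W₂) (f : S ≃ Bool × S₁ × S₂)
    (g : W ≃ Bool × W₁ × W₂) :
    ∃ st : Strategy n X Y S W, ∀ {R : Type} [Fintype R] (a b : ℝ) (v₁ : (S₁ × W₁) × R → ℂ)
      (u₁ : (S₁ × W₁) × Unit → ℂ) (v₂ : (S₂ × W₂) × R → ℂ) (u₂ : (S₂ × W₂) × Unit → ℂ),
      IsUnitVec u₁ → IsUnitVec u₂ →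
      st.cost (mix f g a b v₁ u₁ v₂ u₂) = a ^ 2 * st₁.cost v₁ + b ^ 2 * st₂.cost v₂ ∧
      st.output (mix f g a b v₁ u₁ v₂ u₂)
        = ((a ^ 2 : ℝ) : ℂ) • st₁.output v₁ + ((b ^ 2 : ℝ) : ℂ) • st₂.output v₂ := by
  induction st₁ generalizing S₂ W₂ S W with
  | @done X Y S₁ W₁ _ _ _ _ S₁' W₁' _ _ U₁ hU₁ V₁ hV₁ =>
    cases st₂ with
    | done S₂' W₂' U₂ hU₂ V₂ hV₂ =>
      refine ⟨.done (Bool × X × S₁' × S₂') (Bool × Y × W₁' × W₂') _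
        ((hU₁.sideBySide hU₂).submatrix (controlledSwap X S₁' S₂') f) _
        ((hV₁.sideBySide hV₂).submatrix (controlledSwap Y W₁' W₂') g),
        fun {R} _ a b v₁ u₁ v₂ u₂ h₁ h₂ => ⟨?_, ?_⟩⟩
      · simp [Strategy.cost]
      · change reduced (actRight ((sideBySide V₁ V₂).submatrix (controlledSwap Y W₁' W₂') g)
          (actLeft ((sideBySide U₁ U₂).submatrix (controlledSwap X S₁' S₂') f)
            (mix f g a b v₁ u₁ v₂ u₂))) = _
        rw [actLeft_mix, actRight_mix]
        exact reduced_mix a b _ _ ((h₁.actLeft hU₁).actRight hV₁) ((h₂.actLeft hU₂).actRight hV₂)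
  | send S₁' C₁ U₁ hU₁ rest₁ ih =>
    cases st₂ with
    | send S₂' C₂ U₂ hU₂ rest₂ =>
      obtain ⟨rest, h⟩ := ih rest₂ (pairEquiv C₁ C₂ g) (Equiv.refl (Bool × S₁' × S₂'))
      refine ⟨.send (Bool × S₁' × S₂') (C₁ × C₂) _
        ((hU₁.sideBySide hU₂).submatrix (pairEquiv C₁ C₂ (Equiv.refl _)) f) rest,
        fun {R} _ a b v₁ u₁ v₂ u₂ h₁ h₂ => ?_⟩
      have k₁ := h₁.actLeft hU₁
      have k₂ := h₂.actLeft hU₂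
      obtain ⟨hc, ho⟩ := h a b (handOver (actLeft U₁ v₁)) (handOver (actLeft U₁ u₁))
        (handOver (actLeft U₂ v₂)) (handOver (actLeft U₂ u₂)) k₁.handOver k₂.handOver
      constructor
      · simp only [Strategy.cost, actLeft_mix, handOver_mix, hc, transitState_mix]
        rw [condMutualInfo_transitMix _ _ _ (transitState_posSemidef _) (transitState_posSemidef _)
          (transitState_posSemidef _) (transitState_posSemidef _) k₁.trace_transitState
          k₂.trace_transitState]
        ring
      · simp only [Strategy.output, actLeft_mix, handOver_mix, ho]
        rfl

section Protocol

variable {Ain Bin Aout Bout : Type} [Fintype Ain] [Fintype Bin] [Fintype Aout] [Fintype Bout]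
  {M : ℕ}

theorem IsUnitVec.tensor {A B : Type} [Fintype A] [Fintype B] {v : A → ℂ} {w : B → ℂ}
    (hv : IsUnitVec v) (hw : IsUnitVec w) : IsUnitVec (fun x : A × B => v x.1 * w x.2) := by
  rw [IsUnitVec] at hv hw ⊢
  have h : ∀ x y, v x * w y * star (v x * w y) = v x * star (v x) * (w y * star (w y)) :=
    fun x y => by
      rw [star_mul']
      ring
  simp only [Fintype.sum_prod_type, h, ← Finset.mul_sum, hw, mul_one, hv]

theorem Protocol.isUnitVec_start (P : Protocol Ain Bin Aout Bout M) {R : Type} [Fintype R]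
    {φ : (Ain × Bin) × R → ℂ} (hφ : IsUnitVec φ) : IsUnitVec (P.start φ) := by
  have h := isUnitVec_iff.mpr P.ψ_unit
  rw [IsUnitVec, ← hφ.tensor h]
  exact Fintype.sum_equiv
    { toFun := fun x => (((x.1.1.1, x.1.2.1), x.2), (x.1.1.2, x.1.2.2))
      invFun := fun x => (((x.1.1.1, x.2.1), (x.1.1.2, x.2.2)), x.1.2)
      left_inv := fun _ => rfl
      right_inv := fun _ => rfl } _ _ fun _ => rfl

/-- The shared state of the superposition of two protocols with amplitudes `a` and `b`, including a
dummy input `η`. -/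
def mixShared {T₁ T₁' T₂ T₂' : Type} (a b : ℝ) (η : Ain × Bin → ℂ) (ψ₁ : T₁ × T₁' → ℂ)
    (ψ₂ : T₂ × T₂' → ℂ) : (Bool × Ain × T₁ × T₂) × (Bool × Bin × T₁' × T₂') → ℂ := fun t =>
  (if t.1.1 then if t.2.1 then (a : ℂ) else 0 else if t.2.1 then 0 else (b : ℂ)) *
    (η (t.1.2.1, t.2.2.1) * (ψ₁ (t.1.2.2.1, t.2.2.2.1) * ψ₂ (t.1.2.2.2, t.2.2.2.2)))

theorem isUnitVec_mixShared {T₁ T₁' T₂ T₂' : Type} [Fintype T₁] [Fintype T₁'] [Fintype T₂]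
    [Fintype T₂'] {a b : ℝ} (hab : a ^ 2 + b ^ 2 = 1) {η : Ain × Bin → ℂ} {ψ₁ : T₁ × T₁' → ℂ}
    {ψ₂ : T₂ × T₂' → ℂ} (hη : IsUnitVec η) (h₁ : IsUnitVec ψ₁) (h₂ : IsUnitVec ψ₂) :
    IsUnitVec (mixShared a b η ψ₁ ψ₂) := by
  have h : IsUnitVec (fun x : Bool × Bool =>
      if x.1 then if x.2 then (a : ℂ) else 0 else if x.2 then 0 else (b : ℂ)) := by
    simp only [IsUnitVec, Fintype.sum_prod_type, Fintype.sum_bool]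
    simp
    exact_mod_cast (by linarith : a * a + b * b = 1)
  rw [IsUnitVec, ← h.tensor (hη.tensor (h₁.tensor h₂))]
  exact Fintype.sum_equiv
    { toFun := fun x => ((x.1.1, x.2.1), (x.1.2.1, x.2.2.1), (x.1.2.2.1, x.2.2.2.1),
        (x.1.2.2.2, x.2.2.2.2))
      invFun := fun x => ((x.1.1, x.2.1.1, x.2.2.1.1, x.2.2.2.1),
        (x.1.2, x.2.1.2, x.2.2.1.2, x.2.2.2.2))
      left_inv := fun _ => rfl
      right_inv := fun _ => rfl } _ _ fun _ => rfl

theorem Protocol.exists_mix [Nonempty (Ain × Bin)] (P₁ P₂ : Protocol Ain Bin Aout Bout M) {p : ℝ}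
    (hp : p ∈ Set.Icc (0 : ℝ) 1) :
    ∃ P : Protocol Ain Bin Aout Bout M, ∀ {R : Type} [Fintype R] (φ : (Ain × Bin) × R → ℂ),
      P.QIC φ = p * P₁.QIC φ + (1 - p) * P₂.QIC φ ∧
      P.output φ = (p : ℂ) • P₁.output φ + ((1 - p : ℝ) : ℂ) • P₂.output φ := by
  classical
  obtain ⟨o⟩ := ‹Nonempty (Ain × Bin)›
  -- The dummy input can be any unit vector; a basis vector is a product state and needs no
  -- reference.
  let η : Ain × Bin → ℂ := Pi.single o 1
  have hη : IsUnitVec η := by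
    simp [IsUnitVec, η, Pi.single_apply]
  have hη' : IsUnitVec (fun x : (Ain × Bin) × Unit => η x.1) := by
    rw [IsUnitVec, ← hη]
    simp [Fintype.sum_prod_type]
  have ha : √p ^ 2 = p := Real.sq_sqrt hp.1
  have hb : √(1 - p) ^ 2 = 1 - p := Real.sq_sqrt (sub_nonneg.mpr hp.2)
  obtain ⟨st, h⟩ := P₁.run.exists_mix P₂.run (controlledSwap Ain P₁.TA P₂.TA)
    (controlledSwap Bin P₁.TB P₂.TB)
  refine ⟨⟨Bool × Ain × P₁.TA × P₂.TA, Bool × Bin × P₁.TB × P₂.TB,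
    mixShared √p √(1 - p) η P₁.ψ P₂.ψ, isUnitVec_iff.mp (isUnitVec_mixShared (by rw [ha, hb]; ring)
      hη (isUnitVec_iff.mpr P₁.ψ_unit) (isUnitVec_iff.mpr P₂.ψ_unit)), st⟩, fun {R} _ φ => ?_⟩
  have hs := h √p √(1 - p) (P₁.start φ) (P₁.start fun x => η x.1) (P₂.start φ)
    (P₂.start fun x => η x.1) (P₁.isUnitVec_start hη') (P₂.isUnitVec_start hη')
  rw [ha, hb] at hs
  -- Relabeled by the controlled swaps, the real input tensored with the new shared state is the
  -- superposition of the two starting states.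
  have e : mix (controlledSwap Ain P₁.TA P₂.TA) (controlledSwap Bin P₁.TB P₂.TB) √p √(1 - p)
      (P₁.start φ) (P₁.start fun x => η x.1) (P₂.start φ) (P₂.start fun x => η x.1)
      = fun x => φ ((x.1.1.1, x.1.2.1), x.2)
        * mixShared √p √(1 - p) η P₁.ψ P₂.ψ (x.1.1.2, x.1.2.2) := by
    ext ⟨⟨⟨x, ⟨_ | _, y, s, t⟩⟩, ⟨x', ⟨_ | _, y', s', t'⟩⟩⟩, r⟩ <;>
      simp [Protocol.start, mix, mixShared, controlledSwap] <;> ring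
  rw [e] at hs
  exact hs

end Protocol

/-! ### Joint convexity -/

section Convexity

variable {Ain Bin Aout Bout R : Type} [Fintype Ain] [Fintype Bin] [Fintype Aout] [Fintype Bout]
  [Fintype R]

theorem Protocol.QIC_nonneg {M : ℕ} (P : Protocol Ain Bin Aout Bout M)
    (φ : (Ain × Bin) × R → ℂ) : 0 ≤ P.QIC φ :=
  P.run.cost_nonneg _

theorem exists_mix_mem_protocolsWithError [Nonempty (Ain × Bin)]
    {N₁ N₂ : Matrix (Ain × Bin) (Ain × Bin) ℂ →ₗ[ℂ] Matrix (Aout × Bout) (Aout × Bout) ℂ}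
    (hN₁ : IsChannel N₁) (hN₂ : IsChannel N₂) {φ : (Ain × Bin) × R → ℂ} {p ε₁ ε₂ : ℝ}
    (hp : p ∈ Set.Icc (0 : ℝ) 1) {M₁ M₂ : ℕ} {P₁ : Protocol Ain Bin Aout Bout M₁}
    {P₂ : Protocol Ain Bin Aout Bout M₂} (h₁ : P₁ ∈ protocolsWithError N₁ φ ε₁ M₁)
    (h₂ : P₂ ∈ protocolsWithError N₂ φ ε₂ M₂) :
    ∃ P ∈ protocolsWithError ((p : ℂ) • N₁ + ((1 - p : ℝ) : ℂ) • N₂) φ (p * ε₁ + (1 - p) * ε₂)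
      (max M₁ M₂), P.QIC φ = p * P₁.QIC φ + (1 - p) * P₂.QIC φ := by
  obtain ⟨Q₁, k₁⟩ := P₁.exists_of_le (le_max_left M₁ M₂)
  obtain ⟨Q₂, k₂⟩ := P₂.exists_of_le (le_max_right M₁ M₂)
  obtain ⟨P, h⟩ := Q₁.exists_mix Q₂ hp
  have hψ : (pureState φ).PosSemidef := Matrix.posSemidef_vecMulVec_self_star φ
  refine ⟨P, ?_, ?_⟩
  · change traceDist _ _ ≤ _ at h₁ h₂ ⊢
    rw [(h φ).2, (k₁ φ).2, (k₂ φ).2, withRef_add_smul]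
    refine (traceDist_convex ((P₁.run.output_isHermitian _).sub (hN₁.withRef_isHermitian hψ))
      ((P₂.run.output_isHermitian _).sub (hN₂.withRef_isHermitian hψ)) hp.1
      (sub_nonneg.mpr hp.2)).trans ?_
    exact add_le_add (mul_le_mul_of_nonneg_left h₁ hp.1)
      (mul_le_mul_of_nonneg_left h₂ (sub_nonneg.mpr hp.2))
  · rw [(h φ).1, (k₁ φ).1, (k₂ φ).1]

/-- A bound on all weighted sums of two nonnegative families passes to their infima. -/
theorem le_mul_iInf_add_mul_iInf {ι κ : Sort*} {x : ι → ℝ} {y : κ → ℝ} (hx : ∀ i, 0 ≤ x i)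
    (hy : ∀ j, 0 ≤ y j) {p q : ℝ} (hp : 0 < p) (hq : 0 < q) {L : EReal}
    (hL : ∀ i j, L ≤ ((p * x i + q * y j : ℝ) : EReal)) :
    L ≤ (p : EReal) * (⨅ i, (x i : EReal)) + (q : EReal) * ⨅ j, (y j : EReal) := by
  have hx' : (0 : EReal) ≤ ⨅ i, (x i : EReal) := le_iInf fun i => EReal.coe_nonneg.mpr (hx i)
  have hy' : (0 : EReal) ≤ ⨅ j, (y j : EReal) := le_iInf fun i => EReal.coe_nonneg.mpr (hy i)
  have hp' : (0 : EReal) ≤ p := EReal.coe_nonneg.mpr hp.le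
  have hq' : (0 : EReal) ≤ q := EReal.coe_nonneg.mpr hq.le
  -- Over an empty family the infimum is `⊤`; the right side is then `⊤` because the other summand
  -- is nonnegative, hence not `⊥`.
  rcases isEmpty_or_nonempty ι with hι | hι
  · rw [show ⨅ i, (x i : EReal) = ⊤ from iInf_of_empty _, EReal.coe_mul_top_of_pos hp,
      EReal.top_add_of_ne_bot]
    · exact le_top
    · exact (lt_of_lt_of_le EReal.bot_lt_zero (mul_nonneg hq' hy')).ne'
  rcases isEmpty_or_nonempty κ with hκ | hκ
  · rw [show ⨅ j, (y j : EReal) = ⊤ from iInf_of_empty _, EReal.coe_mul_top_of_pos hq,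
      EReal.add_top_of_ne_bot]
    · exact le_top
    · exact (lt_of_lt_of_le EReal.bot_lt_zero (mul_nonneg hp' hx')).ne'
  have bx : BddBelow (Set.range x) := ⟨0, by rintro _ ⟨i, rfl⟩; exact hx i⟩
  have hby : BddBelow (Set.range y) := ⟨0, by rintro _ ⟨i, rfl⟩; exact hy i⟩
  have ex : ((⨅ i, x i : ℝ) : EReal) ≤ ⨅ i, (x i : EReal) :=
    le_iInf fun i => EReal.coe_le_coe_iff.mpr (ciInf_le bx i)
  have ey : ((⨅ i, y i : ℝ) : EReal) ≤ ⨅ i, (y i : EReal) :=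
    le_iInf fun i => EReal.coe_le_coe_iff.mpr (ciInf_le hby i)
  refine le_trans ?_ (add_le_add (mul_le_mul_of_nonneg_left ex hp')
    (mul_le_mul_of_nonneg_left ey hq'))
  rw [← EReal.coe_mul, ← EReal.coe_mul, ← EReal.coe_add]
  refine EReal.le_of_forall_lt_iff_le.mp fun z hz => ?_
  rw [EReal.coe_lt_coe_iff] at hz
  -- Allowing each infimum an error `δ` costs `(p + q) δ` in total, so `δ` is the gap below `z`
  -- divided by `p + q`.
  obtain ⟨δ, hδ, hz⟩ : ∃ δ > 0, p * (⨅ i, x i) + q * (⨅ j, y j) + (p + q) * δ = z :=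
    ⟨(z - (p * (⨅ i, x i) + q * (⨅ j, y j))) / (p + q), div_pos (by linarith) (by linarith), by
      field_simp
      ring⟩
  obtain ⟨i, hi⟩ := exists_lt_of_ciInf_lt (lt_add_of_pos_right (⨅ i, x i) hδ)
  obtain ⟨j, hj⟩ := exists_lt_of_ciInf_lt (lt_add_of_pos_right (⨅ j, y j) hδ)
  refine (hL i j).trans (EReal.coe_le_coe_iff.mpr ?_)
  nlinarith [mul_lt_mul_of_pos_left hi hp, mul_lt_mul_of_pos_left hj hq]

variable {N : Matrix (Ain × Bin) (Ain × Bin) ℂ →ₗ[ℂ] Matrix (Aout × Bout) (Aout × Bout) ℂ}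
  {φ : (Ain × Bin) × R → ℂ} {ε : ℝ}

theorem boundedQIC_eq (M : ℕ) : boundedQIC M N φ ε
    = ⨅ P : protocolsWithError N φ ε M, ((P.1.QIC φ : ℝ) : EReal) :=
  iInf_subtype' (p := fun P => P ∈ protocolsWithError N φ ε M)
    (f := fun P _ => ((P.QIC φ : ℝ) : EReal))

theorem QIC_eq : QIC N φ ε
    = ⨅ P : Σ M, protocolsWithError N φ ε M, ((P.2.1.QIC φ : ℝ) : EReal) := by
  rw [iInf_sigma]
  exact iInf_congr fun M => boundedQIC_eq M

/-- Settles the endpoints `p = 0` and `p = 1`, where only the bound on the number of messages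
changes. -/
theorem boundedQIC_antitone {M M' : ℕ} (h : M ≤ M') :
    boundedQIC M' N φ ε ≤ boundedQIC M N φ ε := by
  refine le_iInf₂ fun P hP => ?_
  obtain ⟨P', h'⟩ := P.exists_of_le h
  rw [← (h' φ).1]
  refine iInf₂_le P' ?_
  change traceDist _ _ ≤ _ at hP ⊢
  rwa [(h' φ).2]

end Convexity

end QInfo

theorem mainTheorem6 {Ain Bin Aout Bout R : Type}
    [Fintype Ain] [Fintype Bin] [Fintype Aout] [Fintype Bout] [Fintype R]
    (N₁ N₂ : Matrix (Ain × Bin) (Ain × Bin) ℂ →ₗ[ℂ] Matrix (Aout × Bout) (Aout × Bout) ℂ)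
    (hN₁ : QInfo.IsChannel N₁) (hN₂ : QInfo.IsChannel N₂)
    (ρ : Matrix (Ain × Bin) (Ain × Bin) ℂ) (hρ : QInfo.IsDensity ρ)
    (φ : (Ain × Bin) × R → ℂ) (hφ : QInfo.IsPurification φ ρ)
    (p ε₁ ε₂ : ℝ) (hp : p ∈ Set.Icc (0 : ℝ) 1)
    (hε₁ : ε₁ ∈ Set.Icc (0 : ℝ) 2) (hε₂ : ε₂ ∈ Set.Icc (0 : ℝ) 2)
    (M₁ M₂ : ℕ) :
    QInfo.QIC ((p : ℂ) • N₁ + ((1 - p : ℝ) : ℂ) • N₂) φ (p * ε₁ + (1 - p) * ε₂)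
        ≤ (p : EReal) * QInfo.QIC N₁ φ ε₁ + ((1 - p : ℝ) : EReal) * QInfo.QIC N₂ φ ε₂ ∧
      QInfo.boundedQIC (max M₁ M₂)
          ((p : ℂ) • N₁ + ((1 - p : ℝ) : ℂ) • N₂) φ (p * ε₁ + (1 - p) * ε₂)
        ≤ (p : EReal) * QInfo.boundedQIC M₁ N₁ φ ε₁
          + ((1 - p : ℝ) : EReal) * QInfo.boundedQIC M₂ N₂ φ ε₂ := by
  -- The dummy input needs a basis vector; a state of trace one cannot live on the zero space.
  have : Nonempty (Ain × Bin) := by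
    by_contra h
    rw [not_nonempty_iff] at h
    simpa [Matrix.trace] using hρ.2
  -- At the endpoints the term of weight zero may be `0 * ⊤ = 0`, with no protocol to mix in, so
  -- these cases are treated apart.
  rcases hp.1.eq_or_lt with h0 | h0
  · subst h0
    simpa using QInfo.boundedQIC_antitone (le_max_right M₁ M₂)
  rcases hp.2.eq_or_lt with h1 | h1
  · subst h1
    simpa using QInfo.boundedQIC_antitone (le_max_left M₁ M₂)
  constructor
  · rw [QInfo.QIC_eq (N := N₁), QInfo.QIC_eq (N := N₂)]
    refine QInfo.le_mul_iInf_add_mul_iInf (fun P => P.2.1.QIC_nonneg φ)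
      (fun P => P.2.1.QIC_nonneg φ) h0 (sub_pos.mpr h1) fun P₁ P₂ => ?_
    obtain ⟨P, hP, h⟩ := QInfo.exists_mix_mem_protocolsWithError hN₁ hN₂ hp P₁.2.2 P₂.2.2
    rw [← h]
    exact (iInf_le _ _).trans (iInf₂_le P hP)
  · rw [QInfo.boundedQIC_eq (N := N₁), QInfo.boundedQIC_eq (N := N₂)]
    refine QInfo.le_mul_iInf_add_mul_iInf (fun P => P.1.QIC_nonneg φ)
      (fun P => P.1.QIC_nonneg φ) h0 (sub_pos.mpr h1) fun P₁ P₂ => ?_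
    obtain ⟨P, hP, h⟩ := QInfo.exists_mix_mem_protocolsWithError hN₁ hN₂ hp P₁.2 P₂.2
    rw [← h]
    exact iInf₂_le P hP
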